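/- For complex numbers $x,y,z$ put $$R_F(x,y,z)=\tfrac12\int_0^\infty\frac{dt}{\sqrt{t+x}\,\sqrt{t+y}\,\sqrt{t+z}},\qquad R_G(x,y,z)=\tfrac14\int_0^\infty\frac{t}{\sqrt{t+x}\,\sqrt{t+y}\,\sqrt{t+z}}\Big(\frac{x}{t+x}+\frac{y}{t+y}+\frac{z}{t+z}\Big)dt$$ with principal square roots. A number $a$ is said to approximate $v$ with relative error less than $r$ if $|v-a|<r|a|$. Let $x,y\in\mathbb C$ be nonzero with phase less than $\pi$ in magnitude. Put $x_0=\sqrt x$, $y_0=\sqrt y$ and $$x_{m+1}=\frac{x_m+y_m}{2},\qquad y_{m+1}=\sqrt{x_my_m}\qquad(m\ge 0),$$ with principal square roots. Then the integrals for $R_F(x,y,0)$ and $R_G(x,y,0)$ converge absolutely, all $x_m,y_m$ have positive real part (so each square root above is the one with positive real part), and for every $r>0$ there is an $n\ge 0$ with $$|x_n-y_n|<2.7\,\sqrt r\,|x_n|.\qquad(*)$$ 1. If $0<r\le 1/25$ and $n\ge 0$ satisfies $(*)$, then $\pi/(x_n+y_n)$ approximates $R_F(x,y,0)$ with relative error less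 than $r$. 2. There is an absolute constant $C>0$ (independent of $x,y,r,n$) such that, whenever $0<r\le 1/25$ and $n\ge 0$ satisfies $(*)$, $$|2R_G(x,y,0)-G_n|<r\,|G_n|+C\,2^n\,|x_n|\,r^2,\qquad G_n=\Big(\Big(\frac{x_0+y_0}{2}\Big)^2-\sum_{m=1}^n2^{m-2}(x_m-y_m)^2\Big)F,$$ where $F$ is either the computed value $\pi/(x_n+y_n)$ of $R_F(x,y,0)$ or $R_F(x,y,0)$ itself (the sum is empty if $n=0$). That is, $G_n$ approximates $2R_G(x,y,0)$ with relative error less than $r$ if terms of order $r^2$ are neglected. 3. If moreover $R_G(x,y,0)\ne 0$, then for all sufficiently small $r>0$ (depending on $x,y$) and all $n\ge 0$ satisfying $(*)$, $G_n$ (for either choice of $F$) approximates $2R_G(x,y,0)$ with relative error less than $r$. -/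

import Mathlib

open Complex Set MeasureTheory Filter Topology

noncomputable section

/-- Integrand of Carlson's symmetric integral of the first kind: the branch of
`[(t+x)(t+y)(t+z)]^(-1/2)` that is positive for positive `x, y, z` and varies continuously for
`x, y, z` in the plane cut along the nonpositive reals. For `t > 0` each `t+x` stays in the cut
plane, so this branch is the product of the principal square roots. -/
def carlsonRFIntegrand (x y z : ℂ) (t : ℝ) : ℂ :=
  (Complex.sqrt (t + x) * Complex.sqrt (t + y) * Complex.sqrt (t + z))⁻¹

/-- `R_F(x,y,z) = (1/2) ∫_0^∞ [(t+x)(t+y)(t+z)]^(-1/2) dt`. -/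
def carlsonRF (x y z : ℂ) : ℂ :=
  1 / 2 * ∫ t in Ioi (0 : ℝ), carlsonRFIntegrand x y z t

/-- Integrand of Carlson's completely symmetric integral of the second kind. -/
def carlsonRGIntegrand (x y z : ℂ) (t : ℝ) : ℂ :=
  (Complex.sqrt (t + x) * Complex.sqrt (t + y) * Complex.sqrt (t + z))⁻¹ *
    (x / (t + x) + y / (t + y) + z / (t + z)) * t

/-- `R_G(x,y,z) = (1/4) ∫_0^∞ [(t+x)(t+y)(t+z)]^(-1/2) (x/(t+x) + y/(t+y) + z/(t+z)) t dt`. -/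
def carlsonRG (x y z : ℂ) : ℂ :=
  1 / 4 * ∫ t in Ioi (0 : ℝ), carlsonRGIntegrand x y z t

/-- The pair `(x_m, y_m)`: `x_0 = √x`, `y_0 = √y`, `x_{m+1} = (x_m + y_m)/2`,
`y_{m+1} = √(x_m y_m)`, with principal square roots. -/
def complexAGM (x y : ℂ) : ℕ → ℂ × ℂ
  | 0 => (Complex.sqrt x, Complex.sqrt y)
  | m + 1 => (((complexAGM x y m).1 + (complexAGM x y m).2) / 2,
      Complex.sqrt ((complexAGM x y m).1 * (complexAGM x y m).2))

/-- The sequence `x_m`. -/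
def agmX (x y : ℂ) (m : ℕ) : ℂ := (complexAGM x y m).1

/-- The sequence `y_m`. -/
def agmY (x y : ℂ) (m : ℕ) : ℂ := (complexAGM x y m).2

/-- The stopping criterion `|x_n - y_n| < 2.7 √r |x_n|`. -/
def AGMStop (x y : ℂ) (r : ℝ) (n : ℕ) : Prop :=
  ‖agmX x y n - agmY x y n‖ < 2.7 * Real.sqrt r * ‖agmX x y n‖

/-- The computed value `π / (x_n + y_n)` of `R_F(x,y,0)`. -/
def agmRF (x y : ℂ) (n : ℕ) : ℂ := (Real.pi : ℂ) / (agmX x y n + agmY x y n)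

/-- The computed value
`(((x_0 + y_0)/2)^2 - ∑_{m=1}^n 2^(m-2) (x_m - y_m)^2) F` of `2 R_G(x,y,0)`,
where `F` is the value used for `R_F(x,y,0)`. -/
def agmTwoRG (x y : ℂ) (n : ℕ) (F : ℂ) : ℂ :=
  (((agmX x y 0 + agmY x y 0) / 2) ^ 2 -
    ∑ m ∈ Finset.Icc 1 n, (2 : ℂ) ^ ((m : ℤ) - 2) * (agmX x y m - agmY x y m) ^ 2) * F

/-- `a` approximates `v` with relative error less than `r`: the true value `v` lies in the open
disc centred at the computed value `a` with radius `r |a|`. -/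
def RelErrorLT (v a : ℂ) (r : ℝ) : Prop := ‖v - a‖ < r * ‖a‖

end

/-! With `t = s²`, both Carlson integrals become integrals over the real line of even kernels in
`√(s²+a²)` and `√(s²+b²)`, where `a = √x`, `b = √y`. Gauss's form of the Landen transformation shows
that `R_F` is invariant under one arithmetic-geometric step, while `2 R_G` obeys a linear recursion
with an `R_F` term (`agmIntegral_landen`, `agmSecond_landen`).

For complex `a`, `b` the natural substitution `u = (s - ab/s)/2` leaves the real line. So the pair
is first scaled to `ab = 1`. Scaling by a positive real is a change of variable; scaling by a
complex number follows from the identity theorem (`agmIntegral_mul`).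

Let `c = (x_n - y_n)/(x_n + y_n)`. Then `(y_{n+1}/x_{n+1})² = 1 - c²`, so after scaling `R_F` is
`1/(2 x_{n+1})` times an integral that differs from `π` by a relative error of at most
`|c|²/(4(1-|c|²))`. Since `2 x_{n+1} = x_n + y_n`, this compares `R_F` with `π/(x_n + y_n)`. The
stopping rule gives `|c|² ≤ 3.42 r`, which makes the error at most `0.995 r`.

Unrolling the recursion for `R_G` leaves an exact defect of size `2^n |x_{n+1}| |c|⁴`, hence of
order `r²` (`two_mul_carlsonRG_sub_agmTwoRG`). The last claim holds because `2^n |c| → 0` makes this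
defect small against `r |R_G|`, so the slack between `0.995` and `1` absorbs it. -/

/-! ### Principal square roots and the quantities `s² + a²`. -/

lemma csqrt_sq (z : ℂ) : Complex.sqrt z ^ 2 = z := by
  rw [Complex.sqrt]
  exact_mod_cast Complex.cpow_nat_inv_pow z two_ne_zero

lemma norm_csqrt_sq (z : ℂ) : ‖Complex.sqrt z‖ ^ 2 = ‖z‖ := by
  rw [← norm_pow, csqrt_sq]

lemma csqrt_re_pos {z : ℂ} (hz : z ∈ slitPlane) : 0 < (Complex.sqrt z).re := by
  rw [Complex.sqrt, cpow_inv_two_re, Real.sqrt_pos]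
  have h1 := abs_re_le_norm z
  have h2 : -z.re ≤ ‖z‖ := (neg_le_abs _).trans h1
  rcases hz with h | h
  · have := norm_nonneg z
    linarith
  · have h3 : |z.re| < ‖z‖ := abs_re_lt_norm.2 h
    have := neg_le_abs z.re
    linarith

lemma sq_mem_slitPlane {z : ℂ} (hz : 0 < z.re) : z ^ 2 ∈ slitPlane := by
  rw [mem_slitPlane_iff]
  simp only [sq, mul_re, mul_im]
  by_cases h : z.im = 0
  · left
    rw [h]
    nlinarith
  · right
    have := mul_ne_zero hz.ne' h
    intro h'
    apply this
    linarith

/-- The tool for every branch question below: a candidate root is principal as soon as its real part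
is positive. -/
lemma csqrt_eq_of_sq {z w : ℂ} (hz : 0 < z.re) (h : z ^ 2 = w) : Complex.sqrt w = z := by
  have hw : w ∈ slitPlane := h ▸ sq_mem_slitPlane hz
  have h1 := csqrt_re_pos hw
  rcases sq_eq_sq_iff_eq_or_eq_neg.1 ((csqrt_sq w).trans h.symm) with h2 | h2
  · exact h2
  · rw [h2, neg_re] at h1
    linarith

lemma csqrt_ofReal {t : ℝ} (ht : 0 < t) : Complex.sqrt (t : ℂ) = (Real.sqrt t : ℂ) :=
  csqrt_eq_of_sq (by simpa using ht) (by norm_cast; exact Real.sq_sqrt ht.le)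

lemma re_sq_add_sq (s : ℝ) (a : ℂ) : ((s : ℂ) ^ 2 + a ^ 2).re = s ^ 2 + a.re ^ 2 - a.im ^ 2 := by
  simp [sq]
  ring

lemma im_sq_add_sq (s : ℝ) (a : ℂ) : ((s : ℂ) ^ 2 + a ^ 2).im = 2 * (a.re * a.im) := by
  simp [sq]
  ring

lemma sq_add_sq_mem_slitPlane (s : ℝ) {a : ℂ} (ha : 0 < a.re) :
    (s : ℂ) ^ 2 + a ^ 2 ∈ slitPlane := by
  rw [mem_slitPlane_iff, re_sq_add_sq, im_sq_add_sq]
  by_cases h : a.im = 0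
  · left
    rw [h]
    nlinarith [sq_nonneg s, pow_pos ha 2]
  · right
    have := mul_ne_zero ha.ne' h
    simpa using this

/-- The core is `|s²+a²| ≥ (s²+|a|²) Re a/|a|`: the difference of the squares is `(Im a)²
(s²-|a|²)²/|a|²`. Only the bounds `m`, `N` enter the constant, so the estimate is locally uniform in
`a` and can serve as a dominating function. -/
lemma norm_sq_add_sq_ge (s : ℝ) {a : ℂ} {m N : ℝ} (hm : 0 < m) (ham : m ≤ a.re) (haN : ‖a‖ ≤ N) :
    min 1 (m ^ 2) * (m / N) * (1 + s ^ 2) ≤ ‖(s : ℂ) ^ 2 + a ^ 2‖ := by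
  have ha : 0 < a.re := hm.trans_le ham
  have hna : a.re ≤ ‖a‖ := re_le_norm a
  have hna0 : 0 < ‖a‖ := ha.trans_le hna
  have hN : 0 < N := hna0.trans_le haN
  have h2 : ‖a‖ ^ 2 = a.re ^ 2 + a.im ^ 2 := by
    rw [← normSq_eq_norm_sq, normSq_apply]; ring
  have key : (s ^ 2 + ‖a‖ ^ 2) * (a.re / ‖a‖) ≤ ‖(s : ℂ) ^ 2 + a ^ 2‖ := by
    refine le_of_sq_le_sq ?_ (norm_nonneg _)
    rw [← normSq_eq_norm_sq ((s : ℂ) ^ 2 + a ^ 2), normSq_apply, re_sq_add_sq,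
      im_sq_add_sq, mul_pow, div_pow, ← mul_div_assoc, div_le_iff₀ (by positivity), h2]
    nlinarith [mul_nonneg (sq_nonneg a.im) (sq_nonneg (s ^ 2 - (a.re ^ 2 + a.im ^ 2)))]
  refine le_trans ?_ key
  have h3 : min 1 (m ^ 2) * (1 + s ^ 2) ≤ s ^ 2 + ‖a‖ ^ 2 := by
    have e1 := min_le_left 1 (m ^ 2)
    have e2 := min_le_right 1 (m ^ 2)
    have e3 : m ^ 2 ≤ ‖a‖ ^ 2 := by gcongr; linarith
    nlinarith [mul_le_mul_of_nonneg_right e1 (sq_nonneg s)]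
  have h4 : m / N ≤ a.re / ‖a‖ := by gcongr
  calc _ = (min 1 (m ^ 2) * (1 + s ^ 2)) * (m / N) := by ring
    _ ≤ _ := by gcongr

/-! ### The kernels and their integrability. -/

/-- The even rational-radical kernel `s^(2i) / (√(s²+a²)^j √(s²+b²)^l)`. -/
noncomputable def agmKernel (j l i : ℕ) (a b : ℂ) (s : ℝ) : ℂ :=
  (s : ℂ) ^ (2 * i) /
    (Complex.sqrt ((s : ℂ) ^ 2 + a ^ 2) ^ j * Complex.sqrt ((s : ℂ) ^ 2 + b ^ 2) ^ l)

/-- The integral of `agmKernel` over the real line. -/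
noncomputable def agmIntegral (j l i : ℕ) (a b : ℂ) : ℂ := ∫ s : ℝ, agmKernel j l i a b s

lemma csqrt_sq_add_sq_ne_zero (s : ℝ) {a : ℂ} (ha : 0 < a.re) :
    Complex.sqrt ((s : ℂ) ^ 2 + a ^ 2) ≠ 0 := by
  intro h
  have := csqrt_re_pos (sq_add_sq_mem_slitPlane s ha)
  simp [h] at this

lemma continuous_csqrt_sq_add_sq {a : ℂ} (ha : 0 < a.re) :
    Continuous fun s : ℝ => Complex.sqrt ((s : ℂ) ^ 2 + a ^ 2) :=
  continuousOn_sqrt.comp_continuous (by fun_prop) fun s => sq_add_sq_mem_slitPlane s ha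

lemma continuous_agmKernel (j l i : ℕ) {a b : ℂ} (ha : 0 < a.re) (hb : 0 < b.re) :
    Continuous (agmKernel j l i a b) := by
  have := continuous_csqrt_sq_add_sq ha
  have := continuous_csqrt_sq_add_sq hb
  unfold agmKernel
  refine Continuous.div (by fun_prop) (by fun_prop) fun s => ?_
  exact mul_ne_zero (pow_ne_zero _ (csqrt_sq_add_sq_ne_zero s ha))
    (pow_ne_zero _ (csqrt_sq_add_sq_ne_zero s hb))

/-- The hypothesis on the exponents says that the kernel decays at least like `s⁻²`. -/
lemma norm_agmKernel_le {j l i : ℕ} (h : 2 * i + 2 ≤ j + l) {a b : ℂ} {s c : ℝ} (hc : 0 < c)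
    (hca : c * (1 + s ^ 2) ≤ ‖(s : ℂ) ^ 2 + a ^ 2‖) (hcb : c * (1 + s ^ 2) ≤ ‖(s : ℂ) ^ 2 + b ^ 2‖) :
    ‖agmKernel j l i a b s‖ ≤ (Real.sqrt c ^ (j + l))⁻¹ * (1 + s ^ 2)⁻¹ := by
  set R := Real.sqrt (1 + s ^ 2) with hR
  have hR2 : R ^ 2 = 1 + s ^ 2 := Real.sq_sqrt (by positivity)
  have hR1 : 1 ≤ R := Real.one_le_sqrt.2 (by nlinarith [sq_nonneg s])
  have hsR : |s| ≤ R := Real.abs_le_sqrt (by linarith)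
  have low : ∀ d : ℂ, c * (1 + s ^ 2) ≤ ‖(s : ℂ) ^ 2 + d ^ 2‖ →
      Real.sqrt c * R ≤ ‖Complex.sqrt ((s : ℂ) ^ 2 + d ^ 2)‖ := by
    intro d hd
    refine le_of_sq_le_sq ?_ (norm_nonneg _)
    rwa [norm_csqrt_sq, mul_pow, hR2, Real.sq_sqrt hc.le]
  have hc' : 0 < Real.sqrt c := Real.sqrt_pos.2 hc
  have hR0 : 0 < R := by linarith
  rw [agmKernel, norm_div, norm_mul, norm_pow, norm_pow, norm_pow, norm_real, Real.norm_eq_abs,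
    ← hR2, ← mul_inv, ← one_div]
  calc _ ≤ R ^ (2 * i) / ((Real.sqrt c * R) ^ j * (Real.sqrt c * R) ^ l) := by
        gcongr
        · exact low a hca
        · exact low b hcb
    _ ≤ _ := by
        rw [div_le_div_iff₀ (by positivity) (by positivity), ← pow_add, mul_pow, one_mul]
        have : R ^ (2 * i) * R ^ 2 ≤ R ^ (j + l) := by
          rw [← pow_add]
          exact pow_le_pow_right₀ hR1 h
        calc _ = Real.sqrt c ^ (j + l) * (R ^ (2 * i) * R ^ 2) := by ring
          _ ≤ _ := by gcongr

lemma norm_agmKernel_le_of_bounds {j l i : ℕ} (h : 2 * i + 2 ≤ j + l) {m N : ℝ} (hm : 0 < m)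
    (hN : 0 < N) {a b : ℂ} (ham : m ≤ a.re) (haN : ‖a‖ ≤ N) (hbm : m ≤ b.re) (hbN : ‖b‖ ≤ N)
    (s : ℝ) :
    ‖agmKernel j l i a b s‖ ≤
      (Real.sqrt (min 1 (m ^ 2) * (m / N)) ^ (j + l))⁻¹ * (1 + s ^ 2)⁻¹ :=
  norm_agmKernel_le h (by positivity) (norm_sq_add_sq_ge s hm ham haN)
    (norm_sq_add_sq_ge s hm hbm hbN)

lemma integrable_agmKernel {j l i : ℕ} (h : 2 * i + 2 ≤ j + l) {a b : ℂ} (ha : 0 < a.re)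
    (hb : 0 < b.re) : Integrable (agmKernel j l i a b) := by
  refine Integrable.mono' (integrable_inv_one_add_sq.const_mul _)
    (continuous_agmKernel j l i ha hb).aestronglyMeasurable (ae_of_all _ fun s =>
      norm_agmKernel_le_of_bounds h (m := min a.re b.re) (N := max ‖a‖ ‖b‖) (lt_min ha hb)
      (lt_max_of_lt_left (norm_pos_iff.2 ?_)) (min_le_left _ _) (le_max_left _ _)
      (min_le_right _ _) (le_max_right _ _) s)
  rintro rfl
  simp at ha

/-! ### Holomorphy in the parameters and homogeneity. -/

/-- No bound on the derivative is needed: Cauchy's estimate on circles of radius `ε/4` turns the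
bound `B` on the integrand into `B/(ε/4)` on its derivative. -/
lemma differentiableAt_integral_of_dominated {F : ℂ → ℝ → ℂ} {z₀ : ℂ} {ε : ℝ} (hε : 0 < ε)
    {B : ℝ → ℝ} (hB : Integrable B)
    (hmeas : ∀ z ∈ Metric.ball z₀ ε, AEStronglyMeasurable (F z))
    (hdiff : ∀ s, DifferentiableOn ℂ (F · s) (Metric.ball z₀ ε))
    (hbd : ∀ z ∈ Metric.ball z₀ ε, ∀ s, ‖F z s‖ ≤ B s) :
    DifferentiableAt ℂ (fun z => ∫ s, F z s) z₀ := by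
  have hz₀ : z₀ ∈ Metric.ball z₀ ε := Metric.mem_ball_self hε
  have hd : ∀ s, ∀ z ∈ Metric.ball z₀ ε, HasDerivAt (F · s) (deriv (F · s) z) z := fun s z hz =>
    ((hdiff s).differentiableAt (Metric.isOpen_ball.mem_nhds hz)).hasDerivAt
  have hsub : ∀ z ∈ Metric.ball z₀ (ε / 2), Metric.closedBall z (ε / 4) ⊆ Metric.ball z₀ ε := by
    intro z hz w hw
    rw [Metric.mem_ball] at *
    rw [Metric.mem_closedBall] at hw
    linarith [dist_triangle w z z₀]
  refine (hasDerivAt_integral_of_dominated_loc_of_deriv_le (F' := fun z s => deriv (F · s) z)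
    (bound := fun s => B s / (ε / 4)) (Metric.ball_mem_nhds z₀ (half_pos hε))
    ?_ ?_ ?_ ?_ ?_ ?_).2.differentiableAt
  · filter_upwards [Metric.ball_mem_nhds z₀ hε] with z hz using hmeas z hz
  · exact hB.mono' (hmeas _ hz₀) (ae_of_all _ (hbd _ hz₀))
  -- The derivative at `z₀` is measurable in `s` as a pointwise limit of difference quotients along
  -- a sequence.
  · have hu : Tendsto (fun n : ℕ => z₀ + ((n : ℂ) + 1)⁻¹) atTop (𝓝[≠] z₀) := by
      refine tendsto_nhdsWithin_iff.2 ⟨?_, Eventually.of_forall fun n => ?_⟩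
      · have := tendsto_one_div_add_atTop_nhds_zero_nat (𝕜 := ℂ)
        simpa using this.const_add z₀
      · simpa using Nat.cast_add_one_ne_zero n
    have hev : ∀ᶠ n : ℕ in atTop, z₀ + ((n : ℂ) + 1)⁻¹ ∈ Metric.ball z₀ ε :=
      (hu.mono_right nhdsWithin_le_nhds).eventually (Metric.ball_mem_nhds z₀ hε)
    obtain ⟨n₀, hn₀⟩ := eventually_atTop.1 hev
    refine aestronglyMeasurable_of_tendsto_ae (u := atTop)
      (f := fun n s => slope (F · s) z₀ (z₀ + (((n + n₀ : ℕ) : ℂ) + 1)⁻¹)) ?_ ?_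
    · intro n
      simp only [slope_def_field]
      have h1 := (hmeas _ (hn₀ (n + n₀) (by omega))).sub (hmeas _ hz₀)
      simpa only [div_eq_mul_inv, Pi.sub_apply] using h1.mul_const _
    · refine ae_of_all _ fun s => ?_
      have := (hasDerivAt_iff_tendsto_slope.1 (hd s z₀ hz₀)).comp hu
      exact this.comp (tendsto_add_atTop_nat n₀)
  · refine ae_of_all _ fun s z hz => ?_
    refine norm_deriv_le_of_forall_mem_sphere_norm_le (by positivity) ?_ ?_
    · refine DifferentiableOn.diffContOnCl_ball (U := Metric.ball z₀ ε) (hdiff s) ?_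
      exact hsub z hz
    · intro w hw
      exact hbd w (hsub z hz (Metric.sphere_subset_closedBall hw)) s
  · exact hB.div_const _
  · refine ae_of_all _ fun s z hz => hd s z (Metric.ball_subset_ball (by linarith) hz)

lemma differentiableAt_agmIntegral_smul {j l i : ℕ} (h : 2 * i + 2 ≤ j + l) {a b z₀ : ℂ}
    (ha : 0 < (z₀ * a).re) (hb : 0 < (z₀ * b).re) :
    DifferentiableAt ℂ (fun z => agmIntegral j l i (z * a) (z * b)) z₀ := by
  set m := min (z₀ * a).re (z₀ * b).re / 2 with hm
  set N := max ‖z₀ * a‖ ‖z₀ * b‖ + 1 with hN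
  have hm0 : 0 < m := half_pos (lt_min ha hb)
  have hN0 : 0 < N := by positivity
  have ev : ∀ᶠ z in 𝓝 z₀, (m < (z * a).re ∧ ‖z * a‖ < N) ∧ (m < (z * b).re ∧ ‖z * b‖ < N) := by
    have l1 := min_le_left (z₀ * a).re (z₀ * b).re
    have l2 := min_le_right (z₀ * a).re (z₀ * b).re
    have l3 := le_max_left ‖z₀ * a‖ ‖z₀ * b‖
    have l4 := le_max_right ‖z₀ * a‖ ‖z₀ * b‖
    refine ((?_ : ∀ᶠ z in 𝓝 z₀, _).and ?_).and ((?_ : ∀ᶠ z in 𝓝 z₀, _).and ?_)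
    · exact (by fun_prop : Continuous fun z : ℂ => (z * a).re).continuousAt.eventually_const_lt
        (by linarith)
    · exact (by fun_prop : Continuous fun z : ℂ => ‖z * a‖).continuousAt.eventually_lt_const
        (by linarith)
    · exact (by fun_prop : Continuous fun z : ℂ => (z * b).re).continuousAt.eventually_const_lt
        (by linarith)
    · exact (by fun_prop : Continuous fun z : ℂ => ‖z * b‖).continuousAt.eventually_lt_const
        (by linarith)
  obtain ⟨ε, hε, hball⟩ := Metric.eventually_nhds_iff_ball.1 ev
  refine differentiableAt_integral_of_dominated hε
    (integrable_inv_one_add_sq.const_mul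
      (Real.sqrt (min 1 (m ^ 2) * (m / N)) ^ (j + l))⁻¹) ?_ ?_ ?_
  · intro z hz
    obtain ⟨⟨h1, h2⟩, h3, h4⟩ := hball z hz
    exact (continuous_agmKernel j l i (hm0.trans h1) (hm0.trans h3)).aestronglyMeasurable
  · intro s z hz
    obtain ⟨⟨h1, h2⟩, h3, h4⟩ := hball z hz
    have ka := sq_add_sq_mem_slitPlane s (hm0.trans h1)
    have kb := sq_add_sq_mem_slitPlane s (hm0.trans h3)
    have da : DifferentiableAt ℂ (fun z => Complex.sqrt ((s : ℂ) ^ 2 + (z * a) ^ 2)) z :=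
      DifferentiableAt.comp z (differentiableAt_sqrt ka)
        (by fun_prop : DifferentiableAt ℂ (fun z : ℂ => (s : ℂ) ^ 2 + (z * a) ^ 2) z)
    have db : DifferentiableAt ℂ (fun z => Complex.sqrt ((s : ℂ) ^ 2 + (z * b) ^ 2)) z :=
      DifferentiableAt.comp z (differentiableAt_sqrt kb)
        (by fun_prop : DifferentiableAt ℂ (fun z : ℂ => (s : ℂ) ^ 2 + (z * b) ^ 2) z)
    refine DifferentiableAt.differentiableWithinAt ?_
    unfold agmKernel
    refine DifferentiableAt.div (by fun_prop) ((da.pow j).mul (db.pow l)) ?_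
    exact mul_ne_zero (pow_ne_zero _ (csqrt_sq_add_sq_ne_zero s (hm0.trans h1)))
      (pow_ne_zero _ (csqrt_sq_add_sq_ne_zero s (hm0.trans h3)))
  · intro z hz s
    obtain ⟨⟨h1, h2⟩, h3, h4⟩ := hball z hz
    exact norm_agmKernel_le_of_bounds h hm0 hN0 h1.le h2.le h3.le h4.le s

lemma csqrt_ofReal_mul {r : ℝ} (hr : 0 < r) {z : ℂ} (hz : z ∈ slitPlane) :
    Complex.sqrt ((r : ℂ) ^ 2 * z) = r * Complex.sqrt z := by
  refine csqrt_eq_of_sq ?_ ?_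
  · rw [re_ofReal_mul]
    exact mul_pos hr (csqrt_re_pos hz)
  · rw [mul_pow, csqrt_sq]

lemma agmIntegral_ofReal_mul {j l i n : ℕ} (h : j + l = 2 * i + 1 + n) {a b : ℂ} (ha : 0 < a.re)
    (hb : 0 < b.re) {r : ℝ} (hr : 0 < r) :
    (r : ℂ) ^ n * agmIntegral j l i (r * a) (r * b) = agmIntegral j l i a b := by
  have hr' : (r : ℂ) ≠ 0 := by exact_mod_cast hr.ne'
  have hk : ∀ s : ℝ, (r : ℂ) ^ n * (r * agmKernel j l i (r * a) (r * b) (r * s)) =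
      agmKernel j l i a b s := by
    intro s
    have e : ∀ d : ℂ, ((r * s : ℝ) : ℂ) ^ 2 + (r * d) ^ 2 = (r : ℂ) ^ 2 * ((s : ℂ) ^ 2 + d ^ 2) := by
      intro d; push_cast; ring
    have h1 := csqrt_sq_add_sq_ne_zero s ha
    have h2 := csqrt_sq_add_sq_ne_zero s hb
    simp only [agmKernel]
    rw [e, e, csqrt_ofReal_mul hr (sq_add_sq_mem_slitPlane s ha),
      csqrt_ofReal_mul hr (sq_add_sq_mem_slitPlane s hb), mul_pow, mul_pow]
    have e2 : (r : ℂ) ^ j * (r : ℂ) ^ l = (r : ℂ) ^ (2 * i) * r * r ^ n := by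
      rw [← pow_add, h]; ring
    have e3 : (r : ℂ) ^ j * Complex.sqrt ((s : ℂ) ^ 2 + a ^ 2) ^ j *
        ((r : ℂ) ^ l * Complex.sqrt ((s : ℂ) ^ 2 + b ^ 2) ^ l) = ((r : ℂ) ^ j * (r : ℂ) ^ l) *
        (Complex.sqrt ((s : ℂ) ^ 2 + a ^ 2) ^ j * Complex.sqrt ((s : ℂ) ^ 2 + b ^ 2) ^ l) := by
      ring
    rw [e3, e2]
    push_cast
    field_simp
    rw [mul_pow]
  unfold agmIntegral
  have hs := Measure.integral_comp_mul_left (agmKernel j l i (r * a) (r * b)) r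
  rw [← integral_congr_ae (ae_of_all _ hk), integral_const_mul, integral_const_mul, hs, abs_of_pos
    (inv_pos.2 hr), real_smul]
  push_cast
  field_simp

/-- Both sides are holomorphic in `z` on the convex set where `za` and `zb` have positive real part.
They agree at positive real `z`, which accumulate at `1`, so the identity theorem applies. -/
lemma agmIntegral_mul {j l i n : ℕ} (h : j + l = 2 * i + 1 + n) (hn : 1 ≤ n) {a b z : ℂ}
    (ha : 0 < a.re) (hb : 0 < b.re) (hza : 0 < (z * a).re) (hzb : 0 < (z * b).re) :
    z ^ n * agmIntegral j l i (z * a) (z * b) = agmIntegral j l i a b := by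
  set U : Set ℂ := {z | 0 < (z * a).re ∧ 0 < (z * b).re}
  have hUo : IsOpen U :=
    (isOpen_lt continuous_const (by fun_prop : Continuous fun z : ℂ => (z * a).re)).inter
      (isOpen_lt continuous_const (by fun_prop : Continuous fun z : ℂ => (z * b).re))
  have hUc : Convex ℝ U := by
    intro x hx y hy s t hs ht hst
    simp only [U, mem_ofPred_eq, add_mul, real_smul, mul_assoc, add_re, re_ofReal_mul] at *
    rcases hs.eq_or_lt with rfl | hs
    · have ht1 : t = 1 := by linarith
      subst ht1
      simpa using hy
    · have h1 := mul_pos hs hx.1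
      have h2 := mul_pos hs hx.2
      have h3 := mul_nonneg ht hy.1.le
      have h4 := mul_nonneg ht hy.2.le
      exact ⟨by linarith, by linarith⟩
  have hf : AnalyticOnNhd ℂ (fun z => z ^ n * agmIntegral j l i (z * a) (z * b)) U := by
    refine DifferentiableOn.analyticOnNhd (fun z hz => ?_) hUo
    exact ((differentiableAt_pow n).mul
      (differentiableAt_agmIntegral_smul (by omega) hz.1 hz.2)).differentiableWithinAt
  refine hf.eqOn_of_preconnected_of_frequently_eq
    (g := fun _ => agmIntegral j l i a b) analyticOnNhd_const hUc.isPreconnected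
    (z₀ := 1) (by simpa [U] using ⟨ha, hb⟩) ?_ (x := z) ⟨hza, hzb⟩
  have hu : Tendsto (fun n : ℕ => (1 : ℂ) + ((n : ℂ) + 1)⁻¹) atTop (𝓝[≠] 1) := by
    refine tendsto_nhdsWithin_iff.2 ⟨?_, Eventually.of_forall fun n => ?_⟩
    · have := tendsto_one_div_add_atTop_nhds_zero_nat (𝕜 := ℂ)
      simpa using this.const_add 1
    · simpa using Nat.cast_add_one_ne_zero n
  refine hu.frequently (Frequently.of_forall fun k => ?_)
  have := agmIntegral_ofReal_mul h ha hb (r := 1 + ((k : ℝ) + 1)⁻¹) (by positivity)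
  simpa using this

/-! ### Linear relations between the integrals. -/

lemma hasDerivAt_csqrt_sq_add_sq (s : ℝ) {a : ℂ} (ha : 0 < a.re) :
    HasDerivAt (fun z : ℂ => Complex.sqrt (z ^ 2 + a ^ 2))
      (s / Complex.sqrt ((s : ℂ) ^ 2 + a ^ 2)) s := by
  have h1 := hasDerivAt_sqrt (sq_add_sq_mem_slitPlane s ha)
  have h2 : HasDerivAt (fun z : ℂ => z ^ 2 + a ^ 2) (2 * (s : ℂ)) s := by
    simpa using (hasDerivAt_pow 2 (s : ℂ)).add_const (a ^ 2)
  have h3 := h1.comp (s : ℂ) h2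
  refine h3.congr_deriv ?_
  rw [show (-1 / 2 : ℂ) = -(2⁻¹ : ℂ) by norm_num, cpow_neg, ← Complex.sqrt]
  have := csqrt_sq_add_sq_ne_zero s ha
  field_simp

lemma hasDerivAt_mul_agmKernel (s : ℝ) {a b : ℂ} (ha : 0 < a.re) (hb : 0 < b.re) :
    HasDerivAt (fun s : ℝ => (s : ℂ) * agmKernel 1 1 0 a b s)
      (agmKernel 1 1 0 a b s - agmKernel 3 1 1 a b s - agmKernel 1 3 1 a b s) s := by
  have hA := csqrt_sq_add_sq_ne_zero s ha
  have hB := csqrt_sq_add_sq_ne_zero s hb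
  have h := ((hasDerivAt_id (s : ℂ)).div ((hasDerivAt_csqrt_sq_add_sq s ha).mul
    (hasDerivAt_csqrt_sq_add_sq s hb)) (mul_ne_zero hA hB)).comp_ofReal
  refine (h.congr_deriv ?_).congr_of_eventuallyEq (Eventually.of_forall fun t => ?_)
  · simp only [agmKernel, id, Pi.mul_apply]
    field_simp
    ring
  · simp [agmKernel, div_eq_mul_inv]

lemma tendsto_mul_agmKernel {a b : ℂ} (ha : 0 < a.re) (hb : 0 < b.re) {l : Filter ℝ}
    (hl : Tendsto (fun s : ℝ => |s|) l atTop) :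
    Tendsto (fun s : ℝ => (s : ℂ) * agmKernel 1 1 0 a b s) l (𝓝 0) := by
  have hN : 0 < max ‖a‖ ‖b‖ := lt_max_of_lt_left (ha.trans_le (re_le_norm a))
  have hk := norm_agmKernel_le_of_bounds (j := 1) (l := 1) (i := 0) le_rfl (m := min a.re b.re)
    (lt_min ha hb) hN (min_le_left _ _) (le_max_left _ _) (min_le_right _ _) (le_max_right _ _)
  set C := (Real.sqrt (min 1 (min a.re b.re ^ 2) * (min a.re b.re / max ‖a‖ ‖b‖)) ^ (1 + 1))⁻¹
  have hC : 0 ≤ C := by positivity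
  refine squeeze_zero_norm' (a := fun s : ℝ => C * |s|⁻¹) ?_ ?_
  · filter_upwards [hl.eventually_gt_atTop 0] with s hs
    rw [norm_mul, norm_real, Real.norm_eq_abs]
    calc |s| * ‖agmKernel 1 1 0 a b s‖ ≤ |s| * (C * (1 + s ^ 2)⁻¹) := by gcongr; exact hk s
      _ = C * (|s| * (1 + s ^ 2)⁻¹) := by ring
      _ ≤ C * |s|⁻¹ := by
        gcongr
        rw [← sq_abs, ← div_eq_mul_inv, ← one_div, div_le_div_iff₀ (by positivity) hs]
        nlinarith
  · simpa using (tendsto_inv_atTop_zero.comp hl).const_mul C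

/-- Integration by parts: the derivative of `s/(√(s²+a²)√(s²+b²))` integrates to zero because this
function vanishes at both ends. -/
lemma agmIntegral_one_one_zero {a b : ℂ} (ha : 0 < a.re) (hb : 0 < b.re) :
    agmIntegral 1 1 0 a b = agmIntegral 3 1 1 a b + agmIntegral 1 3 1 a b := by
  have i1 := integrable_agmKernel (j := 1) (l := 1) (i := 0) (by norm_num) ha hb
  have i2 := integrable_agmKernel (j := 3) (l := 1) (i := 1) (by norm_num) ha hb
  have i3 := integrable_agmKernel (j := 1) (l := 3) (i := 1) (by norm_num) ha hb
  have h := integral_of_hasDerivAt_of_tendsto (fun s => hasDerivAt_mul_agmKernel s ha hb)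
    ((i1.sub i2).sub i3) (tendsto_mul_agmKernel ha hb tendsto_abs_atBot_atTop)
    (tendsto_mul_agmKernel ha hb tendsto_abs_atTop_atTop)
  rw [integral_sub (f := fun s => agmKernel 1 1 0 a b s - agmKernel 3 1 1 a b s) (i1.sub i2) i3,
    integral_sub i1 i2] at h
  unfold agmIntegral
  linear_combination h

lemma sq_mul_agmIntegral_three_one_zero {a b : ℂ} (ha : 0 < a.re) (hb : 0 < b.re) :
    a ^ 2 * agmIntegral 3 1 0 a b = agmIntegral 1 1 0 a b - agmIntegral 3 1 1 a b := by
  unfold agmIntegral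
  rw [← integral_sub (integrable_agmKernel (by norm_num) ha hb)
    (integrable_agmKernel (by norm_num) ha hb), ← integral_const_mul]
  refine integral_congr_ae (ae_of_all _ fun s => ?_)
  have hA := csqrt_sq_add_sq_ne_zero s ha
  have hB := csqrt_sq_add_sq_ne_zero s hb
  have hA2 := csqrt_sq ((s : ℂ) ^ 2 + a ^ 2)
  simp only [agmKernel]
  field_simp
  linear_combination -hA2

lemma sq_sub_sq_mul_agmIntegral_three_three_one {a b : ℂ} (ha : 0 < a.re) (hb : 0 < b.re) :
    (a ^ 2 - b ^ 2) * agmIntegral 3 3 1 a b = agmIntegral 1 3 1 a b - agmIntegral 3 1 1 a b := by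
  unfold agmIntegral
  rw [← integral_sub (integrable_agmKernel (by norm_num) ha hb)
    (integrable_agmKernel (by norm_num) ha hb), ← integral_const_mul]
  refine integral_congr_ae (ae_of_all _ fun s => ?_)
  have hA := csqrt_sq_add_sq_ne_zero s ha
  have hB := csqrt_sq_add_sq_ne_zero s hb
  have hA2 := csqrt_sq ((s : ℂ) ^ 2 + a ^ 2)
  have hB2 := csqrt_sq ((s : ℂ) ^ 2 + b ^ 2)
  simp only [agmKernel]
  field_simp
  linear_combination (s : ℂ) ^ 2 * (hB2 - hA2)

lemma agmKernel_neg (j l i : ℕ) (a b : ℂ) (s : ℝ) :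
    agmKernel j l i a b (-s) = agmKernel j l i a b s := by
  simp [agmKernel, pow_mul]

lemma agmIntegral_eq_two_mul {j l i : ℕ} (h : 2 * i + 2 ≤ j + l) {a b : ℂ} (ha : 0 < a.re)
    (hb : 0 < b.re) :
    agmIntegral j l i a b = 2 * ∫ s in Ioi (0 : ℝ), agmKernel j l i a b s := by
  have hi := integrable_agmKernel h ha hb
  rw [agmIntegral, ← intervalIntegral.integral_Iic_add_Ioi (b := 0) hi.integrableOn hi.integrableOn,
    two_mul]
  congr 1
  simpa [agmKernel_neg] using (integral_comp_neg_Ioi 0 (agmKernel j l i a b)).symm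

/-! ### The Landen transformation. -/

/-- The substitution `u = (s - 1/s)/2`. -/
lemma integral_eq_integral_Ioi_comp_sub_inv (g : ℝ → ℂ) :
    ∫ u, g u = ∫ s in Ioi (0 : ℝ), (((1 + (s ^ 2)⁻¹) / 2 : ℝ) : ℂ) * g ((s - s⁻¹) / 2) := by
  have hmono : StrictMonoOn (fun s : ℝ => (s - s⁻¹) / 2) (Ioi 0) := by
    intro s hs t ht hst
    have : t⁻¹ < s⁻¹ := inv_strictAnti₀ hs hst
    simp only
    linarith
  have himg : (fun s : ℝ => (s - s⁻¹) / 2) '' Ioi 0 = univ := by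
    -- The positive root of `s² - 2us - 1 = 0`.
    refine eq_univ_of_forall fun u => ⟨u + Real.sqrt (u ^ 2 + 1), ?_, ?_⟩
    · have : |u| < Real.sqrt (u ^ 2 + 1) := Real.lt_sqrt_of_sq_lt (by rw [sq_abs]; linarith)
      have := neg_abs_le u
      simp only [mem_Ioi]
      linarith
    · have h2 := Real.sq_sqrt (by positivity : 0 ≤ u ^ 2 + 1)
      have : (u + Real.sqrt (u ^ 2 + 1))⁻¹ = Real.sqrt (u ^ 2 + 1) - u := by
        refine inv_eq_of_mul_eq_one_right ?_
        linear_combination h2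
      simp only [this]
      ring
  have hder : ∀ s ∈ Ioi (0 : ℝ), HasDerivWithinAt (fun s : ℝ => (s - s⁻¹) / 2)
      ((1 + (s ^ 2)⁻¹) / 2) (Ioi 0) s := by
    intro s hs
    have := ((hasDerivAt_id s).sub (hasDerivAt_inv (ne_of_gt hs))).div_const 2
    simpa using! this.hasDerivWithinAt
  have h := integral_image_eq_integral_abs_deriv_smul measurableSet_Ioi hder hmono.injOn g
  rw [himg, setIntegral_univ] at h
  rw [h]
  refine setIntegral_congr_fun measurableSet_Ioi fun s hs => ?_
  rw [abs_of_nonneg (by positivity), real_smul]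

lemma re_mul_pos_of_im_mul_nonpos {z w : ℂ} (hz : 0 < z.re) (hw : 0 < w.re)
    (h : z.im * w.im ≤ 0) : 0 < (z * w).re := by
  rw [mul_re]
  nlinarith [mul_pos hz hw]

lemma re_pos_and_im_mul_nonpos_of_mul_eq_one {a b : ℂ} (ha : 0 < a.re) (hab : a * b = 1) :
    0 < b.re ∧ a.im * b.im ≤ 0 := by
  have hb : b = a⁻¹ := eq_inv_of_mul_eq_one_right hab
  have ha0 : a ≠ 0 := by rintro rfl; simp at ha
  have hn : 0 < normSq a := normSq_pos.2 ha0
  rw [hb, inv_re, inv_im]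
  refine ⟨by positivity, ?_⟩
  rw [mul_div_assoc', div_nonpos_iff]
  right
  exact ⟨by nlinarith [sq_nonneg a.im], hn.le⟩

/-- Comparing imaginary parts in the squared root shows that `√(s²+d²)` has imaginary part a
positive multiple of that of `d`. -/
lemma im_csqrt_mul_im_csqrt_nonpos (s : ℝ) {a b : ℂ} (ha : 0 < a.re) (hb : 0 < b.re)
    (h : a.im * b.im ≤ 0) :
    (Complex.sqrt ((s : ℂ) ^ 2 + a ^ 2)).im * (Complex.sqrt ((s : ℂ) ^ 2 + b ^ 2)).im ≤ 0 := by
  have key : ∀ {d : ℂ}, 0 < d.re → ∃ k : ℝ, 0 < k ∧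
      (Complex.sqrt ((s : ℂ) ^ 2 + d ^ 2)).im = k * d.im := by
    intro d hd
    have h1 := csqrt_re_pos (sq_add_sq_mem_slitPlane s hd)
    have h2 := congrArg Complex.im (csqrt_sq ((s : ℂ) ^ 2 + d ^ 2))
    rw [im_sq_add_sq, sq, mul_im] at h2
    refine ⟨d.re / (Complex.sqrt ((s : ℂ) ^ 2 + d ^ 2)).re, by positivity, ?_⟩
    field_simp
    linarith
  obtain ⟨k, hk, e1⟩ := key ha
  obtain ⟨k', hk', e2⟩ := key hb
  rw [e1, e2]
  nlinarith [mul_pos hk hk']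

/-- For `ab = 1`, `u² + ((a+b)/2)²` factors as `(s²+a²)(s²+b²)/(4s²)`. The branch is right because
`a` and `b = 1/a` have imaginary parts of opposite sign, so the two roots turn in opposite
directions and their product stays in the right half-plane. -/
lemma csqrt_landen {a b : ℂ} (ha : 0 < a.re) (hab : a * b = 1) {s : ℝ} (hs : 0 < s) :
    Complex.sqrt ((((s - s⁻¹) / 2 : ℝ) : ℂ) ^ 2 + ((a + b) / 2) ^ 2) =
      Complex.sqrt ((s : ℂ) ^ 2 + a ^ 2) * Complex.sqrt ((s : ℂ) ^ 2 + b ^ 2) / (2 * s) ∧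
    Complex.sqrt ((((s - s⁻¹) / 2 : ℝ) : ℂ) ^ 2 + 1 ^ 2) = ((s + s⁻¹) / 2 : ℝ) := by
  obtain ⟨hb, him⟩ := re_pos_and_im_mul_nonpos_of_mul_eq_one ha hab
  have hs' : (s : ℂ) ≠ 0 := by exact_mod_cast hs.ne'
  constructor
  · apply csqrt_eq_of_sq
    · have := re_mul_pos_of_im_mul_nonpos (csqrt_re_pos (sq_add_sq_mem_slitPlane s ha))
        (csqrt_re_pos (sq_add_sq_mem_slitPlane s hb)) (im_csqrt_mul_im_csqrt_nonpos s ha hb him)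
      rw [show (2 * s : ℂ) = ((2 * s : ℝ) : ℂ) by push_cast; ring, div_ofReal_re]
      positivity
    · rw [div_pow, mul_pow, csqrt_sq, csqrt_sq]
      push_cast
      field_simp
      linear_combination (a * b + 1 - 2 * (s : ℂ) ^ 2) * hab
  · apply csqrt_eq_of_sq
    · rw [ofReal_re]
      positivity
    · push_cast
      field_simp
      ring

lemma agmIntegral_landen_of_mul_eq_one {a b : ℂ} (ha : 0 < a.re) (hab : a * b = 1) :
    agmIntegral 1 1 0 ((a + b) / 2) 1 = agmIntegral 1 1 0 a b ∧
    agmIntegral 3 1 0 ((a + b) / 2) 1 = 4 * agmIntegral 3 3 1 a b := by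
  obtain ⟨hb, him⟩ := re_pos_and_im_mul_nonpos_of_mul_eq_one ha hab
  constructor
  · rw [agmIntegral_eq_two_mul (by norm_num) ha hb, agmIntegral,
      integral_eq_integral_Ioi_comp_sub_inv, ← integral_const_mul]
    refine setIntegral_congr_fun measurableSet_Ioi fun s hs => ?_
    have hA := csqrt_sq_add_sq_ne_zero s ha
    have hB := csqrt_sq_add_sq_ne_zero s hb
    have hs0 : s ≠ 0 := ne_of_gt hs
    have hs' : (s : ℂ) ≠ 0 := by exact_mod_cast hs0
    have hs2 : (s : ℂ) ^ 2 + 1 ≠ 0 := by exact_mod_cast (by positivity : s ^ 2 + 1 ≠ 0)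
    simp only [agmKernel]
    rw [(csqrt_landen ha hab hs).1, (csqrt_landen ha hab hs).2]
    push_cast
    field_simp
  · rw [agmIntegral_eq_two_mul (by norm_num) ha hb, agmIntegral,
      integral_eq_integral_Ioi_comp_sub_inv, ← mul_assoc, ← integral_const_mul]
    refine setIntegral_congr_fun measurableSet_Ioi fun s hs => ?_
    have hA := csqrt_sq_add_sq_ne_zero s ha
    have hB := csqrt_sq_add_sq_ne_zero s hb
    have hs0 : s ≠ 0 := ne_of_gt hs
    have hs' : (s : ℂ) ≠ 0 := by exact_mod_cast hs0
    have hs2 : (s : ℂ) ^ 2 + 1 ≠ 0 := by exact_mod_cast (by positivity : s ^ 2 + 1 ≠ 0)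
    simp only [agmKernel]
    rw [(csqrt_landen ha hab hs).1, (csqrt_landen ha hab hs).2]
    push_cast
    field_simp
    norm_num

lemma abs_im_lt_re_of_sq_re_pos {p : ℂ} (hp : 0 < p.re) (h : 0 < (p ^ 2).re) : |p.im| < p.re := by
  rw [sq, mul_re] at h
  exact abs_lt_of_sq_lt_sq (by nlinarith) hp.le

lemma abs_im_csqrt_lt {a : ℂ} (ha : 0 < a.re) :
    |(Complex.sqrt a).im| < (Complex.sqrt a).re :=
  abs_im_lt_re_of_sq_re_pos (csqrt_re_pos (Or.inl ha)) (by rwa [csqrt_sq])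

lemma re_mul_pos_of_abs_im_lt {p q : ℂ} (hp : |p.im| < p.re) (hq : |q.im| < q.re) :
    0 < (p * q).re := by
  have h := mul_lt_mul'' hp hq (abs_nonneg _) (abs_nonneg _)
  rw [← abs_mul] at h
  have := le_abs_self (p.im * q.im)
  rw [mul_re]
  linarith

lemma re_mul_conj_pos_of_abs_im_lt {p q : ℂ} (hp : |p.im| < p.re) (hq : |q.im| < q.re) :
    0 < (p * (starRingEnd ℂ) q).re :=
  re_mul_pos_of_abs_im_lt hp (by simpa using hq)

lemma re_div_pos_of_abs_im_lt {p q : ℂ} (hp : |p.im| < p.re) (hq : |q.im| < q.re) :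
    0 < (p / q).re := by
  have hq0 : q ≠ 0 := by rintro rfl; simp at hq
  have h := re_mul_conj_pos_of_abs_im_lt hp hq
  rw [mul_re, conj_re, conj_im] at h
  rw [div_re, ← add_div]
  exact div_pos (by linarith) (normSq_pos.2 hq0)

/-- Each root lies in the sector `|arg| < π/4`, so the product has positive real part. -/
lemma csqrt_mul_of_re_pos {a b : ℂ} (ha : 0 < a.re) (hb : 0 < b.re) :
    Complex.sqrt (a * b) = Complex.sqrt a * Complex.sqrt b :=
  csqrt_eq_of_sq (re_mul_pos_of_abs_im_lt (abs_im_csqrt_lt ha) (abs_im_csqrt_lt hb))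
    (by rw [mul_pow, csqrt_sq, csqrt_sq])

lemma re_csqrt_mul_pos {a b : ℂ} (ha : 0 < a.re) (hb : 0 < b.re) :
    0 < (Complex.sqrt (a * b)).re := by
  rw [csqrt_mul_of_re_pos ha hb]
  exact re_mul_pos_of_abs_im_lt (abs_im_csqrt_lt ha) (abs_im_csqrt_lt hb)

lemma re_div_csqrt_mul_pos {a b : ℂ} (ha : 0 < a.re) (hb : 0 < b.re) :
    0 < ((Complex.sqrt (a * b))⁻¹ * a).re := by
  have hp := abs_im_csqrt_lt ha
  have hq := abs_im_csqrt_lt hb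
  have := re_div_pos_of_abs_im_lt hp hq
  have ha0 : Complex.sqrt a ≠ 0 := by intro h; simp [h] at hp
  have e : (Complex.sqrt (a * b))⁻¹ * a = Complex.sqrt a / Complex.sqrt b := by
    rw [csqrt_mul_of_re_pos ha hb]
    nth_rw 2 [← csqrt_sq a]
    field_simp
  rwa [e]

lemma re_mean_div_csqrt_mul_pos {a b : ℂ} (ha : 0 < a.re) (hb : 0 < b.re) :
    0 < ((Complex.sqrt (a * b))⁻¹ * ((a + b) / 2)).re := by
  have h1 := re_div_csqrt_mul_pos ha hb
  have h2 := re_div_csqrt_mul_pos hb ha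
  rw [mul_comm b a] at h2
  rw [show (Complex.sqrt (a * b))⁻¹ * ((a + b) / 2) = ((Complex.sqrt (a * b))⁻¹ * a +
    (Complex.sqrt (a * b))⁻¹ * b) / 2 by ring, div_ofNat_re, add_re]
  positivity

/-- Scaling by `1/√(ab)` reduces to the case `ab = 1`. This is legitimate since `a/√(ab) = √a/√b`
and its analogues for `b` and the mean have positive real part. -/
lemma agmIntegral_landen {a b : ℂ} (ha : 0 < a.re) (hb : 0 < b.re) :
    agmIntegral 1 1 0 a b = agmIntegral 1 1 0 ((a + b) / 2) (Complex.sqrt (a * b)) ∧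
    4 * agmIntegral 3 3 1 a b = agmIntegral 3 1 0 ((a + b) / 2) (Complex.sqrt (a * b)) := by
  have hβ := re_csqrt_mul_pos ha hb
  have hβ2 := csqrt_sq (a * b)
  have hza := re_div_csqrt_mul_pos ha hb
  have hzb := re_div_csqrt_mul_pos hb ha
  have hzm := re_mean_div_csqrt_mul_pos ha hb
  rw [mul_comm b a] at hzb
  set β := Complex.sqrt (a * b)
  have hβ0 : β ≠ 0 := by intro h; simp [h] at hβ
  have hm : 0 < ((a + b) / 2).re := by
    rw [div_ofNat_re, add_re]; positivity
  have h1 : (β⁻¹ * a) * (β⁻¹ * b) = 1 := by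
    field_simp
    exact hβ2.symm
  obtain ⟨e1, e2⟩ := agmIntegral_landen_of_mul_eq_one hza h1
  have hz1 : β⁻¹ * β = 1 := inv_mul_cancel₀ hβ0
  have hzβ : 0 < (β⁻¹ * β).re := by rw [hz1]; simp
  rw [show (β⁻¹ * a + β⁻¹ * b) / 2 = β⁻¹ * ((a + b) / 2) by ring] at e1 e2
  constructor
  · rw [← agmIntegral_mul (j := 1) (l := 1) (i := 0) (n := 1) rfl le_rfl ha hb hza hzb,
      ← agmIntegral_mul (j := 1) (l := 1) (i := 0) (n := 1) rfl le_rfl hm hβ hzm hzβ, hz1, e1]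
  · rw [← agmIntegral_mul (j := 3) (l := 3) (i := 1) (n := 3) rfl (by norm_num) ha hb hza hzb,
      ← agmIntegral_mul (j := 3) (l := 1) (i := 0) (n := 3) rfl (by norm_num) hm hβ hzm hzβ, hz1, e2]
    ring

/-- `2 R_G(a², b², 0)` as an integral over the real line. -/
noncomputable def agmSecond (a b : ℂ) : ℂ :=
  (a ^ 2 * agmIntegral 3 1 1 a b + b ^ 2 * agmIntegral 1 3 1 a b) / 2

/-- Split `a²P + b²Q` into the parts carrying `P + Q` and `P - Q`; the two linear relations evaluate
these. -/
lemma two_mul_agmSecond {a b : ℂ} (ha : 0 < a.re) (hb : 0 < b.re) :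
    2 * agmSecond a b = (a ^ 2 + b ^ 2) * (agmIntegral 1 1 0 a b / 2) -
      (a ^ 2 - b ^ 2) ^ 2 * agmIntegral 3 3 1 a b / 2 := by
  have h1 := agmIntegral_one_one_zero ha hb
  have h2 := sq_sub_sq_mul_agmIntegral_three_three_one ha hb
  rw [agmSecond]
  linear_combination -(a ^ 2 + b ^ 2) / 2 * h1 + (a ^ 2 - b ^ 2) / 2 * h2

/-- The second Landen identity expresses both integrals `P`, `Q` of the new pair through `K` and `W`
of the old one, and `two_mul_agmSecond` does the same for the old pair. -/
lemma agmSecond_landen {a b : ℂ} (ha : 0 < a.re) (hb : 0 < b.re) :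
    agmSecond a b = 2 * agmSecond ((a + b) / 2) (Complex.sqrt (a * b)) -
      a * b * (agmIntegral 1 1 0 a b / 2) := by
  obtain ⟨l1, l2⟩ := agmIntegral_landen ha hb
  have hβ := re_csqrt_mul_pos ha hb
  have hβ2 := csqrt_sq (a * b)
  have hm : 0 < ((a + b) / 2).re := by
    rw [div_ofNat_re, add_re]; positivity
  have h0 := two_mul_agmSecond ha hb
  have h1 := agmIntegral_one_one_zero hm hβ
  have h2 := sq_mul_agmIntegral_three_one_zero hm hβ
  simp only [agmSecond] at *
  set β := Complex.sqrt (a * b)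
  rw [← l1] at h1 h2
  rw [← l2] at h2
  rw [hβ2]
  set K := agmIntegral 1 1 0 a b
  set W := agmIntegral 3 3 1 a b
  set P := agmIntegral 3 1 1 ((a + b) / 2) β
  set Q := agmIntegral 1 3 1 ((a + b) / 2) β
  have hQ : Q = (a + b) ^ 2 * W := by linear_combination -h1 - h2
  have hP : P = K - (a + b) ^ 2 * W := by linear_combination -h1 - hQ
  rw [hP, hQ]
  linear_combination h0 / 2

/-! ### Carlson's integrals under `t = s²`. -/

lemma carlsonRFIntegrand_sq {s : ℝ} (hs : 0 < s) (x y : ℂ) :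
    (s : ℂ) * carlsonRFIntegrand x y 0 (s ^ 2) =
      agmKernel 1 1 0 (Complex.sqrt x) (Complex.sqrt y) s := by
  have hs' : (s : ℂ) ≠ 0 := by exact_mod_cast hs.ne'
  rw [carlsonRFIntegrand, agmKernel, csqrt_sq, csqrt_sq, add_zero, csqrt_ofReal (by positivity),
    Real.sqrt_sq hs.le]
  push_cast
  field_simp

lemma carlsonRGIntegrand_sq {s : ℝ} (hs : 0 < s) {x y : ℂ} (hx : x ∈ slitPlane)
    (hy : y ∈ slitPlane) :
    (s : ℂ) * carlsonRGIntegrand x y 0 (s ^ 2) =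
      x * agmKernel 3 1 1 (Complex.sqrt x) (Complex.sqrt y) s +
        y * agmKernel 1 3 1 (Complex.sqrt x) (Complex.sqrt y) s := by
  have hs' : (s : ℂ) ≠ 0 := by exact_mod_cast hs.ne'
  have hA := csqrt_sq_add_sq_ne_zero s (csqrt_re_pos hx)
  have hB := csqrt_sq_add_sq_ne_zero s (csqrt_re_pos hy)
  have hA2 := csqrt_sq ((s : ℂ) ^ 2 + x)
  have hB2 := csqrt_sq ((s : ℂ) ^ 2 + y)
  rw [carlsonRGIntegrand, agmKernel, agmKernel, add_zero, csqrt_ofReal (by positivity),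
    Real.sqrt_sq hs.le]
  rw [csqrt_sq] at hA hB
  rw [csqrt_sq, csqrt_sq]
  push_cast
  set A := Complex.sqrt ((s : ℂ) ^ 2 + x)
  set B := Complex.sqrt ((s : ℂ) ^ 2 + y)
  rw [← hA2, ← hB2]
  field_simp
  ring

lemma integrableOn_carlsonRFIntegrand {x y : ℂ} (hx : x ∈ slitPlane) (hy : y ∈ slitPlane) :
    IntegrableOn (carlsonRFIntegrand x y 0) (Ioi (0 : ℝ)) := by
  rw [← integrableOn_Ioi_comp_rpow_iff' _ (two_ne_zero (α := ℝ))]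
  refine (integrable_agmKernel (j := 1) (l := 1) (i := 0) (by norm_num) (csqrt_re_pos hx)
    (csqrt_re_pos hy)).integrableOn.congr_fun (fun s hs => ?_) measurableSet_Ioi
  rw [← carlsonRFIntegrand_sq hs]
  norm_num

lemma integrableOn_carlsonRGIntegrand {x y : ℂ} (hx : x ∈ slitPlane) (hy : y ∈ slitPlane) :
    IntegrableOn (carlsonRGIntegrand x y 0) (Ioi (0 : ℝ)) := by
  rw [← integrableOn_Ioi_comp_rpow_iff' _ (two_ne_zero (α := ℝ))]
  have h1 := (integrable_agmKernel (j := 3) (l := 1) (i := 1) (by norm_num) (csqrt_re_pos hx)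
    (csqrt_re_pos hy)).const_mul x
  have h2 := (integrable_agmKernel (j := 1) (l := 3) (i := 1) (by norm_num) (csqrt_re_pos hx)
    (csqrt_re_pos hy)).const_mul y
  refine (h1.add h2).integrableOn.congr_fun (fun s hs => ?_) measurableSet_Ioi
  simp only [Pi.add_apply]
  rw [← carlsonRGIntegrand_sq hs hx hy]
  norm_num

lemma carlsonRF_eq {x y : ℂ} (hx : x ∈ slitPlane) (hy : y ∈ slitPlane) :
    carlsonRF x y 0 = agmIntegral 1 1 0 (Complex.sqrt x) (Complex.sqrt y) / 2 := by
  rw [carlsonRF, agmIntegral_eq_two_mul (by norm_num) (csqrt_re_pos hx) (csqrt_re_pos hy),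
    ← integral_comp_rpow_Ioi_of_pos two_pos, mul_div_cancel_left₀ _ two_ne_zero,
    ← integral_const_mul]
  refine setIntegral_congr_fun measurableSet_Ioi fun s hs => ?_
  rw [← carlsonRFIntegrand_sq hs]
  norm_num
  ring

lemma two_mul_carlsonRG_eq {x y : ℂ} (hx : x ∈ slitPlane) (hy : y ∈ slitPlane) :
    2 * carlsonRG x y 0 = agmSecond (Complex.sqrt x) (Complex.sqrt y) := by
  have i1 := (integrable_agmKernel (j := 3) (l := 1) (i := 1) (by norm_num) (csqrt_re_pos hx)
    (csqrt_re_pos hy)).const_mul x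
  have i2 := (integrable_agmKernel (j := 1) (l := 3) (i := 1) (by norm_num) (csqrt_re_pos hx)
    (csqrt_re_pos hy)).const_mul y
  rw [carlsonRG, agmSecond, agmIntegral_eq_two_mul (by norm_num) (csqrt_re_pos hx) (csqrt_re_pos hy),
    agmIntegral_eq_two_mul (by norm_num) (csqrt_re_pos hx) (csqrt_re_pos hy), csqrt_sq, csqrt_sq]
  rw [show ∀ p q : ℂ, (x * (2 * p) + y * (2 * q)) / 2 = x * p + y * q by intros; ring,
    ← integral_const_mul x, ← integral_const_mul y, ← integral_add i1.integrableOn i2.integrableOn,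
    ← integral_comp_rpow_Ioi_of_pos two_pos, ← mul_assoc, ← integral_const_mul]
  refine setIntegral_congr_fun measurableSet_Ioi fun s hs => ?_
  rw [← carlsonRGIntegrand_sq hs hx hy]
  norm_num
  ring

/-! ### Invariance along the iteration and the exact defect for `R_G`. -/

lemma agmX_succ (x y : ℂ) (m : ℕ) : agmX x y (m + 1) = (agmX x y m + agmY x y m) / 2 := rfl

lemma agmY_succ (x y : ℂ) (m : ℕ) :
    agmY x y (m + 1) = Complex.sqrt (agmX x y m * agmY x y m) := rfl

lemma agm_re_pos {x y : ℂ} (hx : x ∈ slitPlane) (hy : y ∈ slitPlane) (m : ℕ) :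
    0 < (agmX x y m).re ∧ 0 < (agmY x y m).re := by
  induction m with
  | zero => exact ⟨csqrt_re_pos hx, csqrt_re_pos hy⟩
  | succ m ih =>
    refine ⟨?_, re_csqrt_mul_pos ih.1 ih.2⟩
    rw [agmX_succ, div_ofNat_re, add_re]
    linarith [ih.1, ih.2]

lemma agmIntegral_agm {x y : ℂ} (hx : x ∈ slitPlane) (hy : y ∈ slitPlane) (m : ℕ) :
    agmIntegral 1 1 0 (agmX x y m) (agmY x y m) / 2 = carlsonRF x y 0 := by
  induction m with
  | zero => exact (carlsonRF_eq hx hy).symm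
  | succ m ih =>
    obtain ⟨h1, h2⟩ := agm_re_pos hx hy m
    rw [agmX_succ, agmY_succ, ← (agmIntegral_landen h1 h2).1, ih]

/-- The defect of the truncated arithmetic-geometric sum. -/
lemma two_mul_carlsonRG_sub_agmTwoRG {x y : ℂ} (hx : x ∈ slitPlane) (hy : y ∈ slitPlane) (n : ℕ) :
    2 * carlsonRG x y 0 - agmTwoRG x y n (carlsonRF x y 0) =
      -(2 ^ n * ((agmX x y (n + 1) ^ 2 - agmY x y (n + 1) ^ 2) ^ 2 *
        agmIntegral 3 3 1 (agmX x y (n + 1)) (agmY x y (n + 1)) / 2)) := by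
  have step : ∀ n, agmSecond (agmX x y n) (agmY x y n) =
      2 * agmSecond (agmX x y (n + 1)) (agmY x y (n + 1)) -
        agmX x y n * agmY x y n * carlsonRF x y 0 := by
    intro n
    obtain ⟨h1, h2⟩ := agm_re_pos hx hy n
    rw [agmSecond_landen h1 h2, agmIntegral_agm hx hy n, agmX_succ, agmY_succ]
  have sqY : ∀ n, agmY x y (n + 1) ^ 2 = agmX x y n * agmY x y n := fun n => csqrt_sq _
  have main : ∀ n, 2 * carlsonRG x y 0 - agmTwoRG x y n (carlsonRF x y 0) =
      2 ^ n * (agmSecond (agmX x y n) (agmY x y n) -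
        agmX x y (n + 1) ^ 2 * carlsonRF x y 0) := by
    intro n
    induction n with
    | zero =>
      rw [two_mul_carlsonRG_eq hx hy, agmTwoRG, agmX_succ]
      simp [agmX, agmY, complexAGM]
    | succ n ih =>
      have hp : (2 : ℂ) ^ (((n + 1 : ℕ) : ℤ) - 2) = 2 ^ n / 2 := by
        rw [show ((n + 1 : ℕ) : ℤ) - 2 = (n : ℤ) - 1 by push_cast; ring,
          zpow_sub_one₀ two_ne_zero, zpow_natCast, div_eq_mul_inv]
      have hT : agmTwoRG x y (n + 1) (carlsonRF x y 0) = agmTwoRG x y n (carlsonRF x y 0) -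
          2 ^ n / 2 * (agmX x y (n + 1) - agmY x y (n + 1)) ^ 2 * carlsonRF x y 0 := by
        rw [agmTwoRG, agmTwoRG, Finset.sum_Icc_succ_top (by omega), hp]
        ring
      rw [hT, agmX_succ x y (n + 1)]
      have h1 := step n
      have h2 := sqY n
      rw [pow_succ]
      linear_combination ih + 2 ^ n * h1 + 2 ^ n * carlsonRF x y 0 * h2
  -- One more Landen step on the form `main`: since `y_{n+1}² = x_n y_n`, all multiples of `R_F`
  -- cancel and only the term quadratic in `x_{n+1}² - y_{n+1}²` survives.
  obtain ⟨h1, h2⟩ := agm_re_pos hx hy (n + 1)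
  have h3 := two_mul_agmSecond h1 h2
  rw [agmIntegral_agm hx hy (n + 1)] at h3
  have h4 := step n
  have h5 := sqY n
  rw [main]
  linear_combination 2 ^ n * h4 + 2 ^ n * h3 + 2 ^ n * carlsonRF x y 0 * h5

/-! ### Quadratic convergence and the stopping rule. -/

/-- The ratio `(x_n - y_n) / (x_n + y_n)`. -/
noncomputable def agmRatio (x y : ℂ) (n : ℕ) : ℂ :=
  (agmX x y n - agmY x y n) / (agmX x y n + agmY x y n)

lemma agm_add_ne_zero {x y : ℂ} (hx : x ∈ slitPlane) (hy : y ∈ slitPlane) (n : ℕ) :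
    agmX x y n + agmY x y n ≠ 0 := by
  obtain ⟨h1, h2⟩ := agm_re_pos hx hy n
  intro h
  have := congrArg Complex.re h
  rw [add_re, zero_re] at this
  linarith

lemma norm_sub_lt_norm_add {p q : ℂ} (hp : |p.im| < p.re) (hq : |q.im| < q.re) :
    ‖p - q‖ < ‖p + q‖ := by
  have h := re_mul_conj_pos_of_abs_im_lt hp hq
  refine lt_of_pow_lt_pow_left₀ 2 (norm_nonneg _) ?_
  rw [← normSq_eq_norm_sq, ← normSq_eq_norm_sq, normSq_sub, normSq_add]
  linarith

/-- Put `z = (√x_n - √y_n)/(√x_n + √y_n)`, of modulus below `1` because both roots lie in `|arg| <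
π/4`. The next ratio is `z²` and the present one is `2z/(1+z²)`, whence `|z| ≤ |c_n|`. The initial
ratio may have modulus at least `1`; the bound below `1` starts at index `1`. -/
lemma norm_agmRatio_succ {x y : ℂ} (hx : x ∈ slitPlane) (hy : y ∈ slitPlane) (n : ℕ) :
    ‖agmRatio x y (n + 1)‖ < 1 ∧ ‖agmRatio x y (n + 1)‖ ≤ ‖agmRatio x y n‖ ^ 2 := by
  obtain ⟨h1, h2⟩ := agm_re_pos hx hy n
  have hs := agm_add_ne_zero hx hy n
  have hp := abs_im_csqrt_lt h1
  have hq := abs_im_csqrt_lt h2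
  have hX := csqrt_sq (agmX x y n)
  have hY := csqrt_sq (agmY x y n)
  have hlt := norm_sub_lt_norm_add hp hq
  set p := Complex.sqrt (agmX x y n)
  set q := Complex.sqrt (agmY x y n)
  have hpq : p + q ≠ 0 := norm_pos_iff.1 ((norm_nonneg _).trans_lt hlt)
  set z := (p - q) / (p + q) with hz
  have hz1 : ‖z‖ < 1 := by
    rw [hz, norm_div, div_lt_one (norm_pos_iff.2 hpq)]
    exact hlt
  have hc : agmRatio x y (n + 1) = z ^ 2 := by
    rw [agmRatio, agmX_succ, agmY_succ, csqrt_mul_of_re_pos h1 h2, hz]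
    change ((agmX x y n + agmY x y n) / 2 - p * q) / ((agmX x y n + agmY x y n) / 2 + p * q) = _
    rw [← hX, ← hY, div_pow, div_eq_div_iff _ (pow_ne_zero 2 hpq)]
    · ring
    · rw [show (p ^ 2 + q ^ 2) / 2 + p * q = (p + q) ^ 2 / 2 by ring]
      exact div_ne_zero (pow_ne_zero 2 hpq) two_ne_zero
  have hcz : 2 * z = agmRatio x y n * (1 + z ^ 2) := by
    rw [agmRatio, hz]
    rw [← hX, ← hY] at hs ⊢
    field_simp
    ring
  have hzc : ‖z‖ ≤ ‖agmRatio x y n‖ := by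
    have e1 := congrArg norm hcz
    rw [norm_mul, norm_mul] at e1
    norm_num at e1
    have e2 : ‖1 + z ^ 2‖ ≤ 2 := by
      refine (norm_add_le _ _).trans ?_
      rw [norm_one, norm_pow]
      nlinarith [norm_nonneg z]
    nlinarith [mul_le_mul_of_nonneg_left e2 (norm_nonneg (agmRatio x y n))]
  rw [hc, norm_pow]
  refine ⟨?_, by gcongr⟩
  nlinarith [norm_nonneg z]

lemma norm_agmRatio_succ_le {x y : ℂ} (hx : x ∈ slitPlane) (hy : y ∈ slitPlane) (m : ℕ) :
    ‖agmRatio x y (m + 1)‖ ≤ ‖agmRatio x y 1‖ ^ 2 ^ m := by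
  induction m with
  | zero => simp
  | succ m ih =>
    refine (norm_agmRatio_succ hx hy (m + 1)).2.trans ?_
    rw [pow_succ 2 m, pow_mul]
    gcongr

lemma tendsto_two_pow_mul_norm_agmRatio {x y : ℂ} (hx : x ∈ slitPlane) (hy : y ∈ slitPlane) :
    Tendsto (fun n : ℕ => (2 : ℝ) ^ n * ‖agmRatio x y n‖) atTop (𝓝 0) := by
  have hρ := (norm_agmRatio_succ hx hy 0).1
  rw [zero_add] at hρ
  rw [← tendsto_add_atTop_iff_nat 1]
  have h1 : Tendsto (fun m : ℕ => 2 ^ m) atTop atTop :=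
    tendsto_pow_atTop_atTop_of_one_lt (one_lt_two : (1 : ℕ) < 2)
  have h2 := ((tendsto_self_mul_const_pow_of_lt_one (norm_nonneg _) hρ).comp h1).const_mul 2
  rw [mul_zero] at h2
  refine squeeze_zero (fun m => by positivity) (fun m => ?_) h2
  have := norm_agmRatio_succ_le hx hy m
  simp only [Function.comp_apply]
  push_cast
  rw [pow_succ]
  calc _ = 2 * (2 ^ m * ‖agmRatio x y (m + 1)‖) := by ring
    _ ≤ _ := by gcongr

lemma norm_agmX_le {x y : ℂ} (n : ℕ) :
    ‖agmX x y n‖ ≤ max ‖agmX x y 0‖ ‖agmY x y 0‖ ∧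
      ‖agmY x y n‖ ≤ max ‖agmX x y 0‖ ‖agmY x y 0‖ := by
  set M := max ‖agmX x y 0‖ ‖agmY x y 0‖
  induction n with
  | zero => exact ⟨le_max_left _ _, le_max_right _ _⟩
  | succ n ih =>
    have hM : 0 ≤ M := (norm_nonneg _).trans ih.1
    constructor
    · rw [agmX_succ, norm_div, Complex.norm_ofNat, div_le_iff₀ two_pos]
      linarith [norm_add_le (agmX x y n) (agmY x y n), ih.1, ih.2]
    · refine le_of_sq_le_sq ?_ hM
      rw [agmY_succ, norm_csqrt_sq, norm_mul, sq]
      exact mul_le_mul ih.1 ih.2 (norm_nonneg _) hM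

lemma agm_sub_eq {x y : ℂ} (hx : x ∈ slitPlane) (hy : y ∈ slitPlane) (n : ℕ) :
    (agmX x y n - agmY x y n) * (1 + agmRatio x y n) = 2 * agmRatio x y n * agmX x y n := by
  have := agm_add_ne_zero hx hy n
  rw [agmRatio]
  field_simp
  ring

lemma exists_agmStop {x y : ℂ} (hx : x ∈ slitPlane) (hy : y ∈ slitPlane) {r : ℝ} (hr : 0 < r) :
    ∃ n, AGMStop x y r n := by
  have hr' := Real.sqrt_pos.2 hr
  have hc : ∀ᶠ n in atTop, ‖agmRatio x y n‖ < min (1 / 2) (Real.sqrt r / 2) := by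
    have h := (tendsto_two_pow_mul_norm_agmRatio hx hy).eventually_lt_const
      (show (0 : ℝ) < min (1 / 2) (Real.sqrt r / 2) by positivity)
    filter_upwards [h] with n hn
    refine lt_of_le_of_lt ?_ hn
    exact le_mul_of_one_le_left (norm_nonneg _) (one_le_pow₀ one_le_two)
  obtain ⟨n, hn⟩ := hc.exists
  refine ⟨n, ?_⟩
  have hX : 0 < ‖agmX x y n‖ := (agm_re_pos hx hy n).1.trans_le (re_le_norm _)
  have h := congrArg norm (agm_sub_eq hx hy n)
  rw [norm_mul, norm_mul, norm_mul] at h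
  norm_num at h
  have h1 := (lt_min_iff.1 hn).1
  have h2 := (lt_min_iff.1 hn).2
  -- From `x_n - y_n = 2c x_n/(1+c)` this gives `|x_n - y_n| ≤ 4|c||x_n| < 2√r |x_n|`.
  have h3 : 1 / 2 ≤ ‖1 + agmRatio x y n‖ := by
    have := norm_sub_le (1 + agmRatio x y n) (agmRatio x y n)
    rw [add_sub_cancel_right, norm_one] at this
    linarith
  rw [AGMStop]
  have h4 := mul_le_mul_of_nonneg_left h3 (norm_nonneg (agmX x y n - agmY x y n))
  have h5 := mul_lt_mul_of_pos_right h2 hX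
  nlinarith [mul_pos hr' hX]

lemma sq_norm_agmRatio_le_of_agmStop {x y : ℂ} {r : ℝ} {n : ℕ} (hr : 0 < r) (hr' : r ≤ 1 / 25)
    (h : AGMStop x y r n) : ‖agmRatio x y n‖ ^ 2 ≤ 3.42 * r := by
  rw [AGMStop] at h
  set s := Real.sqrt r with hs
  have hs2 : s ^ 2 = r := Real.sq_sqrt hr.le
  have hs0 : 0 < s := Real.sqrt_pos.2 hr
  have hs1 : s ≤ 1 / 5 := by
    rw [hs, Real.sqrt_le_left (by norm_num)]
    norm_num at hr' ⊢
    exact hr'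
  have hX : 0 < ‖agmX x y n‖ := by
    by_contra hX
    have : ‖agmX x y n‖ = 0 := le_antisymm (not_lt.1 hX) (norm_nonneg _)
    rw [this, mul_zero] at h
    exact absurd h (not_lt.2 (norm_nonneg _))
  -- `1.46 = 2 - 2.7/5`, using `√r ≤ 1/5`; then `(2.7/1.46)² < 3.42`.
  have h1 : 1.46 * ‖agmX x y n‖ ≤ ‖agmX x y n + agmY x y n‖ := by
    have h2 := norm_sub_norm_le (2 * agmX x y n) (agmX x y n - agmY x y n)
    rw [show 2 * agmX x y n - (agmX x y n - agmY x y n) = agmX x y n + agmY x y n by ring,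
      norm_mul, Complex.norm_ofNat] at h2
    nlinarith [mul_le_mul_of_nonneg_right hs1 hX.le]
  have h2 : ‖agmRatio x y n‖ ≤ 2.7 * s / 1.46 := by
    rw [agmRatio, norm_div, div_le_div_iff₀ (by linarith) (by norm_num)]
    nlinarith [mul_le_mul_of_nonneg_left h1 (by positivity : 0 ≤ 2.7 * s)]
  calc ‖agmRatio x y n‖ ^ 2 ≤ (2.7 * s / 1.46) ^ 2 := by gcongr
    _ = (2.7 / 1.46) ^ 2 * r := by rw [← hs2]; ring
    _ ≤ 3.42 * r := by
      gcongr
      norm_num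

/-! ### Estimates for nearly equal arguments. -/

lemma integral_inv_one_add_sq_sq :
    Integrable (fun s : ℝ => ((1 + s ^ 2) ^ 2)⁻¹) ∧ ∫ s : ℝ, ((1 + s ^ 2) ^ 2)⁻¹ = Real.pi / 2 := by
  have h1 : (0 : ℝ) < (1 : ℂ).re := by simp
  have hsq : ∀ s : ℝ, Complex.sqrt ((s : ℂ) ^ 2 + 1 ^ 2) ^ 2 = 1 + (s : ℂ) ^ 2 := fun s => by
    rw [csqrt_sq]; ring
  have k1 : ∀ s : ℝ, agmKernel 1 1 0 1 1 s = (((1 + s ^ 2)⁻¹ : ℝ) : ℂ) := fun s => by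
    rw [agmKernel, ← pow_add, hsq]; push_cast; simp
  have k2 : ∀ s : ℝ, agmKernel 3 1 0 1 1 s = ((((1 + s ^ 2) ^ 2)⁻¹ : ℝ) : ℂ) := fun s => by
    rw [agmKernel, ← pow_add, show 3 + 1 = 2 * 2 from rfl, pow_mul _ 2 2, hsq]; push_cast; simp
  have e1 := agmIntegral_one_one_zero h1 h1
  have e2 := sq_mul_agmIntegral_three_one_zero h1 h1
  have e3 : agmIntegral 1 3 1 1 1 = agmIntegral 3 1 1 1 1 := by
    simp only [agmIntegral, agmKernel, mul_comm]
  have e4 : agmIntegral 1 1 0 1 1 = Real.pi := by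
    simp only [agmIntegral, k1]
    rw [integral_complex_ofReal, integral_univ_inv_one_add_sq]
  have e5 : agmIntegral 3 1 0 1 1 = ((∫ s : ℝ, ((1 + s ^ 2) ^ 2)⁻¹ : ℝ) : ℂ) := by
    simp only [agmIntegral, k2]
    rw [integral_complex_ofReal]
  constructor
  · refine Integrable.mono' integrable_inv_one_add_sq
      (by fun_prop : Measurable fun s : ℝ => ((1 + s ^ 2) ^ 2)⁻¹).aestronglyMeasurable
      (ae_of_all _ fun s => ?_)
    rw [Real.norm_of_nonneg (by positivity)]
    exact inv_anti₀ (by positivity) (le_self_pow₀ (by nlinarith [sq_nonneg s]) two_ne_zero)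
  · have : ((∫ s : ℝ, ((1 + s ^ 2) ^ 2)⁻¹ : ℝ) : ℂ) = ((Real.pi / 2 : ℝ) : ℂ) := by
      rw [← e5]
      push_cast
      linear_combination e2 + e1 / 2 + e3 / 2 + e4 / 2
    exact_mod_cast this

/-- With `z = √(1-v)`, `1/z - 1 = v/(z(1+z))`, and both `Re z` and `(Re z)²` are at least `1 - |v|`.
-/
lemma norm_inv_csqrt_one_sub_sub_one_le {v : ℂ} (hv : ‖v‖ < 1) :
    ‖(Complex.sqrt (1 - v))⁻¹ - 1‖ ≤ ‖v‖ / (2 * (1 - ‖v‖)) := by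
  have hre : 1 - ‖v‖ ≤ (1 - v).re := by
    rw [sub_re, one_re]
    linarith [re_le_norm v]
  have hz := csqrt_re_pos (z := 1 - v) (Or.inl (by linarith))
  have hz2 := csqrt_sq (1 - v)
  set z := Complex.sqrt (1 - v)
  have hz0 : z ≠ 0 := by intro h; simp [h] at hz
  have hre2 : 1 - ‖v‖ ≤ z.re ^ 2 := by
    rw [← hz2, sq, mul_re] at hre
    nlinarith [mul_self_nonneg z.im]
  have hzre : 1 - ‖v‖ ≤ z.re := by
    nlinarith [norm_nonneg v]
  have hz1 : z.re ≤ ‖z‖ := re_le_norm z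
  have hz1' : 1 + z.re ≤ ‖1 + z‖ := by simpa using re_le_norm (1 + z)
  have h1z : 1 + z ≠ 0 := norm_pos_iff.1 (by linarith)
  have e : z⁻¹ - 1 = v / (z * (1 + z)) := by
    field_simp
    linear_combination -hz2
  rw [e, norm_div, norm_mul]
  refine div_le_div_of_nonneg_left (norm_nonneg v) (by linarith) ?_
  calc 2 * (1 - ‖v‖) ≤ z.re * (1 + z.re) := by nlinarith
    _ ≤ _ := mul_le_mul hz1 hz1' (by linarith) (norm_nonneg _)

/-- With `R² = 1+s²` the kernel is `R⁻²(1 - q/R²)^(-1/2)`. Keeping the extra `R⁻²` in the excess and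
using `∫ R⁻⁴ = π/2` gives the factor `1/4` instead of `1/2`, which the constant `2.7` depends on. -/
lemma norm_agmIntegral_one_sub_pi_le {w q : ℂ} (hw : 0 < w.re) (hwq : w ^ 2 = 1 - q)
    (hq : ‖q‖ < 1) :
    ‖agmIntegral 1 1 0 1 w - Real.pi‖ ≤ Real.pi * (‖q‖ / (4 * (1 - ‖q‖))) := by
  have h1 : (0 : ℝ) < (1 : ℂ).re := by simp
  have hpi : (Real.pi : ℂ) = ∫ s : ℝ, (((1 + s ^ 2)⁻¹ : ℝ) : ℂ) := by
    rw [integral_complex_ofReal, integral_univ_inv_one_add_sq]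
  have hint : Integrable fun s : ℝ => (((1 + s ^ 2)⁻¹ : ℝ) : ℂ) := integrable_inv_one_add_sq.ofReal
  rw [hpi, agmIntegral, ← integral_sub (integrable_agmKernel (by norm_num) h1 hw) hint]
  obtain ⟨hi, hv⟩ := integral_inv_one_add_sq_sq
  have hpos : 0 < 1 - ‖q‖ := by linarith
  calc _ ≤ ∫ s : ℝ, ‖q‖ / (2 * (1 - ‖q‖)) * ((1 + s ^ 2) ^ 2)⁻¹ := by
        refine norm_integral_le_of_norm_le (hi.const_mul _) (ae_of_all _ fun s => ?_)
        set R := Real.sqrt (1 + s ^ 2) with hR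
        have hR2 : R ^ 2 = 1 + s ^ 2 := Real.sq_sqrt (by positivity)
        have hR0 : 0 < R := Real.sqrt_pos.2 (by positivity)
        have hR1 : 1 ≤ R ^ 2 := by rw [hR2]; nlinarith [sq_nonneg s]
        have hRC : (R : ℂ) ≠ 0 := by exact_mod_cast hR0.ne'
        have hR2C : (R : ℂ) ^ 2 = 1 + (s : ℂ) ^ 2 := by exact_mod_cast hR2
        set v := q / (R : ℂ) ^ 2 with hvdef
        have hnv : ‖v‖ = ‖q‖ / R ^ 2 := by
          rw [hvdef, norm_div, norm_pow, norm_real, Real.norm_of_nonneg hR0.le]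
        have hvq : ‖v‖ ≤ ‖q‖ := by rw [hnv]; exact div_le_self (norm_nonneg _) hR1
        have a1 : Complex.sqrt ((s : ℂ) ^ 2 + 1 ^ 2) = R :=
          csqrt_eq_of_sq (by simpa using hR0) (by rw [hR2C]; ring)
        have a2 : Complex.sqrt ((s : ℂ) ^ 2 + w ^ 2) = R * Complex.sqrt (1 - v) := by
          rw [← csqrt_ofReal_mul hR0]
          · congr 1
            rw [hwq, mul_sub, hvdef, mul_div_cancel₀ _ (pow_ne_zero 2 hRC), hR2C]
            ring
          · left
            rw [sub_re, one_re]
            linarith [re_le_norm v]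
        have hz0 : Complex.sqrt (1 - v) ≠ 0 := by
          intro h
          have h2 := csqrt_sq_add_sq_ne_zero s hw
          rw [a2, h, mul_zero] at h2
          exact h2 rfl
        have e : agmKernel 1 1 0 1 w s - (((1 + s ^ 2)⁻¹ : ℝ) : ℂ) =
            ((R : ℂ) ^ 2)⁻¹ * ((Complex.sqrt (1 - v))⁻¹ - 1) := by
          rw [agmKernel, a1, a2, ← hR2]
          push_cast
          field_simp
        rw [e, norm_mul, norm_inv, norm_pow, norm_real, Real.norm_of_nonneg hR0.le, ← hR2]
        calc _ ≤ (R ^ 2)⁻¹ * (‖v‖ / (2 * (1 - ‖v‖))) := by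
              gcongr
              exact norm_inv_csqrt_one_sub_sub_one_le (hvq.trans_lt hq)
          _ ≤ (R ^ 2)⁻¹ * ((‖q‖ / R ^ 2) / (2 * (1 - ‖q‖))) := by
              rw [← hnv]
              gcongr
          _ = _ := by
              field_simp
    _ = _ := by
        rw [integral_const_mul, hv]
        field_simp
        ring

lemma norm_agmIntegral_three_three_one_le {w q : ℂ} (hwq : w ^ 2 = 1 - q)
    (hq : ‖q‖ < 1) :
    ‖agmIntegral 3 3 1 1 w‖ ≤ ((1 - ‖q‖) ^ 3)⁻¹ * Real.pi := by
  have hpos : 0 < 1 - ‖q‖ := by linarith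
  have hsq : Real.sqrt (1 - ‖q‖) ^ (3 + 3) = (1 - ‖q‖) ^ 3 := by
    rw [show 3 + 3 = 2 * 3 from rfl, pow_mul, Real.sq_sqrt hpos.le]
  rw [← integral_univ_inv_one_add_sq, ← integral_const_mul, agmIntegral, ← hsq]
  refine norm_integral_le_of_norm_le (integrable_inv_one_add_sq.const_mul _)
    (ae_of_all _ fun s => norm_agmKernel_le (by norm_num) hpos ?_ ?_)
  · have : (s : ℂ) ^ 2 + 1 ^ 2 = ((1 + s ^ 2 : ℝ) : ℂ) := by push_cast; ring
    rw [this, norm_real, Real.norm_of_nonneg (by positivity)]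
    nlinarith [mul_nonneg (norm_nonneg q) (by positivity : 0 ≤ 1 + s ^ 2)]
  · have : (s : ℂ) ^ 2 + w ^ 2 = ((1 + s ^ 2 : ℝ) : ℂ) - q := by rw [hwq]; push_cast; ring
    rw [this]
    refine le_trans ?_ (norm_sub_norm_le _ _)
    rw [norm_real, Real.norm_of_nonneg (by positivity)]
    nlinarith [mul_nonneg (norm_nonneg q) (sq_nonneg s)]

/-! ### Error bounds for the computed values. -/

section
variable {x y : ℂ}

lemma agmY_div_agmX_succ (hx : x ∈ slitPlane) (hy : y ∈ slitPlane) (n : ℕ) :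
    0 < ((agmX x y (n + 1))⁻¹ * agmY x y (n + 1)).re ∧
      ((agmX x y (n + 1))⁻¹ * agmY x y (n + 1)) ^ 2 = 1 - agmRatio x y n ^ 2 := by
  obtain ⟨h1, h2⟩ := agm_re_pos hx hy n
  have hs := agm_add_ne_zero hx hy n
  have hY0 : Complex.sqrt (agmX x y n * agmY x y n) ≠ 0 := by
    intro h
    have := re_csqrt_mul_pos h1 h2
    simp [h] at this
  have h := re_mean_div_csqrt_mul_pos h1 h2
  rw [agmX_succ, agmY_succ]
  constructor
  · have e : ((agmX x y n + agmY x y n) / 2)⁻¹ * Complex.sqrt (agmX x y n * agmY x y n) =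
      ((Complex.sqrt (agmX x y n * agmY x y n))⁻¹ * ((agmX x y n + agmY x y n) / 2))⁻¹ := by
      rw [mul_inv, inv_inv, mul_comm]
    rw [e, inv_re]
    refine div_pos h (normSq_pos.2 ?_)
    intro h0
    simp [h0] at h
  · rw [mul_pow, csqrt_sq, agmRatio]
    field_simp
    ring

/-- The relative error of the computed value of `R_F`. -/
lemma norm_carlsonRF_sub_agmRF_le (hx : x ∈ slitPlane) (hy : y ∈ slitPlane) {n : ℕ}
    (hq : ‖agmRatio x y n‖ ^ 2 < 1) :
    ‖carlsonRF x y 0 - agmRF x y n‖ ≤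
      ‖agmRatio x y n‖ ^ 2 / (4 * (1 - ‖agmRatio x y n‖ ^ 2)) * ‖agmRF x y n‖ := by
  obtain ⟨h1, h2⟩ := agm_re_pos hx hy (n + 1)
  obtain ⟨hw, hw2⟩ := agmY_div_agmX_succ hx hy n
  have hX0 : agmX x y (n + 1) ≠ 0 := by intro h; simp [h] at h1
  have hz1 : (agmX x y (n + 1))⁻¹ * agmX x y (n + 1) = 1 := inv_mul_cancel₀ hX0
  have hsc := agmIntegral_mul (j := 1) (l := 1) (i := 0) (n := 1) rfl le_rfl h1 h2
    (z := (agmX x y (n + 1))⁻¹) (by rw [hz1]; simp) hw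
  have hK := agmIntegral_agm hx hy (n + 1)
  have hRF : agmRF x y n = Real.pi / (2 * agmX x y (n + 1)) := by
    rw [agmRF, agmX_succ, mul_div_cancel₀ _ two_ne_zero]
  have hn := norm_agmIntegral_one_sub_pi_le hw hw2 (by rwa [norm_pow])
  rw [norm_pow] at hn
  rw [hz1, pow_one] at hsc
  rw [← hK, ← hsc, hRF]
  set w := (agmX x y (n + 1))⁻¹ * agmY x y (n + 1)
  rw [show (agmX x y (n + 1))⁻¹ * agmIntegral 1 1 0 1 w / 2 - Real.pi / (2 * agmX x y (n + 1)) =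
    (agmIntegral 1 1 0 1 w - Real.pi) / (2 * agmX x y (n + 1)) by field_simp, norm_div, norm_div,
    norm_real, Real.norm_of_nonneg Real.pi_pos.le, mul_div_assoc']
  gcongr
  linarith

/-- The truncation error of the arithmetic-geometric sum for `2 R_G`. -/
lemma norm_two_mul_carlsonRG_sub_le (hx : x ∈ slitPlane) (hy : y ∈ slitPlane) {n : ℕ}
    (hq : ‖agmRatio x y n‖ ^ 2 ≤ 1 / 2) :
    ‖2 * carlsonRG x y 0 - agmTwoRG x y n (carlsonRF x y 0)‖ ≤
      16 * (2 ^ n * ‖agmX x y (n + 1)‖ * ‖agmRatio x y n‖ ^ 4) := by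
  obtain ⟨h1, h2⟩ := agm_re_pos hx hy (n + 1)
  obtain ⟨hw, hw2⟩ := agmY_div_agmX_succ hx hy n
  have hX0 : agmX x y (n + 1) ≠ 0 := by intro h; simp [h] at h1
  have hz1 : (agmX x y (n + 1))⁻¹ * agmX x y (n + 1) = 1 := inv_mul_cancel₀ hX0
  have hsc := agmIntegral_mul (j := 3) (l := 3) (i := 1) (n := 3) rfl (by norm_num) h1 h2
    (z := (agmX x y (n + 1))⁻¹) (by rw [hz1]; simp) hw
  have hn := norm_agmIntegral_three_three_one_le hw2 (by rw [norm_pow]; linarith)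
  rw [norm_pow] at hn
  rw [hz1] at hsc
  rw [two_mul_carlsonRG_sub_agmTwoRG hx hy, ← hsc]
  -- Squared, this supplies `c⁴`; the powers of `x_{n+1}` are `4` from here and `-3` from
  -- homogeneity, leaving one.
  have e : agmX x y (n + 1) ^ 2 - agmY x y (n + 1) ^ 2 =
      agmX x y (n + 1) ^ 2 * agmRatio x y n ^ 2 := by
    rw [mul_pow] at hw2
    field_simp at hw2
    linear_combination -hw2
  rw [e]
  set w := (agmX x y (n + 1))⁻¹ * agmY x y (n + 1)
  set X := agmX x y (n + 1)
  set c := agmRatio x y n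
  rw [show -(2 ^ n * ((X ^ 2 * c ^ 2) ^ 2 * (X⁻¹ ^ 3 * agmIntegral 3 3 1 1 w) / 2)) =
    -(2 ^ n * (X * c ^ 4 * agmIntegral 3 3 1 1 w) / 2) by field_simp]
  rw [norm_neg, norm_div, norm_mul, norm_mul, norm_mul, norm_pow, norm_pow, Complex.norm_ofNat]
  have h8 : ((1 - ‖c‖ ^ 2) ^ 3)⁻¹ ≤ 8 := by
    have h12 : (1 / 2 : ℝ) ≤ 1 - ‖c‖ ^ 2 := by linarith
    calc ((1 - ‖c‖ ^ 2) ^ 3)⁻¹ ≤ ((1 / 2) ^ 3)⁻¹ := by gcongr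
      _ = 8 := by norm_num
  have h32 : ‖agmIntegral 3 3 1 1 w‖ ≤ 32 := by
    refine hn.trans ?_
    nlinarith [Real.pi_pos, Real.pi_le_four]
  calc _ ≤ 2 ^ n * (‖X‖ * ‖c‖ ^ 4 * 32) / 2 := by gcongr
    _ = _ := by ring

lemma agmTwoRG_eq_mul (x y : ℂ) (n : ℕ) (F : ℂ) : agmTwoRG x y n F = agmTwoRG x y n 1 * F := by
  simp [agmTwoRG]

/-- Under the stopping criterion, the value computed for `R_F` has relative error at most
`0.995 r`. -/
lemma norm_carlsonRF_sub_agmRF_le_of_agmStop (hx : x ∈ slitPlane) (hy : y ∈ slitPlane) {r : ℝ}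
    {n : ℕ} (hr : 0 < r) (hr' : r ≤ 1 / 25) (h : AGMStop x y r n) :
    ‖carlsonRF x y 0 - agmRF x y n‖ ≤ 0.995 * r * ‖agmRF x y n‖ := by
  have hq := sq_norm_agmRatio_le_of_agmStop hr hr' h
  have hq' : ‖agmRatio x y n‖ ^ 2 ≤ 0.1368 := by linarith
  refine (norm_carlsonRF_sub_agmRF_le hx hy (by linarith)).trans ?_
  gcongr
  -- The factor is at most `3.42 r/(4 · 0.8632)`, which is below `0.991 r`.
  rw [div_le_iff₀ (by linarith)]
  nlinarith

/-- The total error of the value computed for `2 R_G`. -/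
lemma norm_two_mul_carlsonRG_sub_agmTwoRG_le (hx : x ∈ slitPlane) (hy : y ∈ slitPlane) {r : ℝ}
    {n : ℕ} {F : ℂ} (hr : 0 < r) (hr' : r ≤ 1 / 25) (h : AGMStop x y r n)
    (hF : F = agmRF x y n ∨ F = carlsonRF x y 0) :
    ‖2 * carlsonRG x y 0 - agmTwoRG x y n F‖ ≤
      0.995 * r * ‖agmTwoRG x y n F‖ +
        16 * (2 ^ n * ‖agmX x y (n + 1)‖ * ‖agmRatio x y n‖ ^ 4) := by
  have hq := sq_norm_agmRatio_le_of_agmStop hr hr' h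
  have h1 := norm_two_mul_carlsonRG_sub_le hx hy (n := n) (by linarith)
  rcases hF with rfl | rfl
  · have h2 : ‖agmTwoRG x y n (carlsonRF x y 0) - agmTwoRG x y n (agmRF x y n)‖ ≤
        0.995 * r * ‖agmTwoRG x y n (agmRF x y n)‖ := by
      rw [agmTwoRG_eq_mul, agmTwoRG_eq_mul _ _ _ (agmRF x y n), ← mul_sub, norm_mul, norm_mul,
        mul_left_comm]
      gcongr
      exact norm_carlsonRF_sub_agmRF_le_of_agmStop hx hy hr hr' h
    have h3 := norm_sub_le_norm_sub_add_norm_sub (2 * carlsonRG x y 0)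
      (agmTwoRG x y n (carlsonRF x y 0)) (agmTwoRG x y n (agmRF x y n))
    linarith
  · have : 0 ≤ 0.995 * r * ‖agmTwoRG x y n (carlsonRF x y 0)‖ := by positivity
    linarith

lemma norm_agmX_succ_le_of_agmStop {r : ℝ} {n : ℕ} (hr' : r ≤ 1 / 25)
    (h : AGMStop x y r n) : ‖agmX x y (n + 1)‖ ≤ 2 * ‖agmX x y n‖ := by
  rw [AGMStop] at h
  have hs1 : Real.sqrt r ≤ 1 / 5 := by
    rw [Real.sqrt_le_left (by norm_num)]
    norm_num at hr' ⊢
    exact hr'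
  have h2 := norm_sub_le (2 * agmX x y n) (agmX x y n - agmY x y n)
  rw [show 2 * agmX x y n - (agmX x y n - agmY x y n) = agmX x y n + agmY x y n by ring,
    norm_mul, Complex.norm_ofNat] at h2
  rw [agmX_succ, norm_div, Complex.norm_ofNat, div_le_iff₀ two_pos]
  nlinarith [mul_le_mul_of_nonneg_right hs1 (norm_nonneg (agmX x y n)), norm_nonneg (agmX x y n)]

/-- For small `r`, the criterion forces `n` to be large unless the iteration is stationary. -/
lemma eventually_agmStop_small (hx : x ∈ slitPlane) (hy : y ∈ slitPlane) {η : ℝ} (hη : 0 < η) :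
    ∀ᶠ r : ℝ in 𝓝[>] 0, ∀ n, AGMStop x y r n → 2 ^ n * ‖agmRatio x y n‖ < η := by
  obtain ⟨N, hN⟩ := eventually_atTop.1
    ((tendsto_two_pow_mul_norm_agmRatio hx hy).eventually_lt_const hη)
  -- Each of the finitely many `n < N` with `x_n ≠ y_n` fails the criterion once `r` is small
  -- enough.
  have hfin : ∀ᶠ r : ℝ in 𝓝[>] 0, ∀ n ∈ Finset.range N, AGMStop x y r n → agmRatio x y n = 0 := by
    rw [Finset.eventually_all]
    intro n _
    by_cases h0 : agmX x y n - agmY x y n = 0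
    · exact Eventually.of_forall fun r _ => by rw [agmRatio, h0, zero_div]
    · have hc : ContinuousAt (fun r : ℝ => 2.7 * Real.sqrt r * ‖agmX x y n‖) 0 := by fun_prop
      have := hc.eventually_lt_const (u := ‖agmX x y n - agmY x y n‖)
        (by simpa using h0)
      filter_upwards [this.filter_mono nhdsWithin_le_nhds] with r hr hcrit
      exact absurd hcrit (not_lt.2 hr.le)
  filter_upwards [hfin] with r hr n hn
  by_cases hnN : n < N
  · rw [hr n (Finset.mem_range.2 hnN) hn]
    simpa using hη
  · exact hN n (not_lt.1 hnN)

lemma eventually_relErrorLT_carlsonRG (hx : x ∈ slitPlane) (hy : y ∈ slitPlane)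
    (hG : carlsonRG x y 0 ≠ 0) :
    ∀ᶠ r : ℝ in 𝓝[>] 0, ∀ (n : ℕ) (F : ℂ), AGMStop x y r n →
      F = agmRF x y n ∨ F = carlsonRF x y 0 →
      RelErrorLT (2 * carlsonRG x y 0) (agmTwoRG x y n F) r := by
  set M := max ‖agmX x y 0‖ ‖agmY x y 0‖ + 1 with hM
  have hM0 : 0 < M := by positivity
  set g := ‖carlsonRG x y 0‖ with hg
  have hg0 : 0 < g := norm_pos_iff.2 hG
  set η := g * 0.00001 / M with hη
  have hη0 : 0 < η := by positivity
  filter_upwards [eventually_agmStop_small hx hy hη0, self_mem_nhdsWithin,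
    Ioc_mem_nhdsGT (show (0 : ℝ) < 1 / 25 by norm_num)] with r hsmall _ hr n F hcrit hF
  have hr0' : 0 < r := hr.1
  have h1 := norm_two_mul_carlsonRG_sub_agmTwoRG_le hx hy hr.1 hr.2 hcrit hF
  have hq := sq_norm_agmRatio_le_of_agmStop hr.1 hr.2 hcrit
  have hX : ‖agmX x y (n + 1)‖ ≤ M := by linarith [(norm_agmX_le (x := x) (y := y) (n + 1)).1]
  have hc1 : ‖agmRatio x y n‖ ≤ 1 := by nlinarith [norm_nonneg (agmRatio x y n), hr.2]
  have hs := hsmall n hcrit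
  set c := ‖agmRatio x y n‖
  have hc0 : 0 ≤ c := norm_nonneg _
  -- Of `c⁴`, one factor tames `2^n`, two give `r`, and one is bounded by `1`. The result stays
  -- below the slack `0.005 r |G|` because `g ≤ |G|`.
  have herr : 16 * (2 ^ n * ‖agmX x y (n + 1)‖ * c ^ 4) ≤ 0.001 * r * g := by
    calc 16 * (2 ^ n * ‖agmX x y (n + 1)‖ * c ^ 4)
        = 16 * ((2 ^ n * c) * ‖agmX x y (n + 1)‖ * (c * c ^ 2)) := by ring
      _ ≤ 16 * (η * M * (1 * (3.42 * r))) := by gcongr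
      _ = 16 * 0.00001 * 3.42 * r * g := by rw [hη]; field_simp
      _ ≤ 0.001 * r * g := by gcongr; norm_num
  rw [RelErrorLT]
  set G := agmTwoRG x y n F
  have h2 : 2 * g ≤ ‖2 * carlsonRG x y 0 - G‖ + ‖G‖ := by
    have := norm_add_le (2 * carlsonRG x y 0 - G) G
    rw [sub_add_cancel, norm_mul, Complex.norm_ofNat] at this
    exact this
  have h3 : g ≤ ‖G‖ := by
    nlinarith [norm_nonneg G, mul_le_mul_of_nonneg_right hr.2 (norm_nonneg G),
      mul_le_mul_of_nonneg_right hr.2 hg0.le]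
  nlinarith [mul_pos hr0' hg0, mul_le_mul_of_nonneg_left h3 hr0'.le]

end

theorem mainTheorem5 :
    ∃ C : ℝ, 0 < C ∧ ∀ x y : ℂ, x ≠ 0 → y ≠ 0 → |x.arg| < Real.pi → |y.arg| < Real.pi →
      -- the two integrals converge absolutely
      IntegrableOn (carlsonRFIntegrand x y 0) (Ioi (0 : ℝ)) ∧
      IntegrableOn (carlsonRGIntegrand x y 0) (Ioi (0 : ℝ)) ∧
      -- each square root in the iteration has positive real part
      (∀ m : ℕ, 0 < (agmX x y m).re ∧ 0 < (agmY x y m).re) ∧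
      -- the iteration terminates
      (∀ r : ℝ, 0 < r → ∃ n : ℕ, AGMStop x y r n) ∧
      -- the value computed for `R_F` has relative error less than `r`
      (∀ (r : ℝ) (n : ℕ), 0 < r → r ≤ 1 / 25 → AGMStop x y r n →
        RelErrorLT (carlsonRF x y 0) (agmRF x y n) r) ∧
      -- the value computed for `2 R_G` has relative error less than `r`
      -- up to a term of order `r ^ 2`
      (∀ (r : ℝ) (n : ℕ) (F : ℂ), 0 < r → r ≤ 1 / 25 → AGMStop x y r n →
        F = agmRF x y n ∨ F = carlsonRF x y 0 →
        ‖2 * carlsonRG x y 0 - agmTwoRG x y n F‖ <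
          r * ‖agmTwoRG x y n F‖ + C * 2 ^ n * ‖agmX x y n‖ * r ^ 2) ∧
      -- if `R_G` does not vanish, the relative error is less than `r` once `r` is small
      (carlsonRG x y 0 ≠ 0 →
        ∀ᶠ r : ℝ in 𝓝[>] 0, ∀ (n : ℕ) (F : ℂ), AGMStop x y r n →
          F = agmRF x y n ∨ F = carlsonRF x y 0 →
          RelErrorLT (2 * carlsonRG x y 0) (agmTwoRG x y n F) r) := by
  -- Any constant above `16 · 2 · 3.42² = 374.2848` works.
  refine ⟨1000, by norm_num, fun x y hx0 hy0 hxa hya => ?_⟩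
  have hx : x ∈ slitPlane :=
    mem_slitPlane_iff_arg.2 ⟨fun h => by simp [h, abs_of_pos Real.pi_pos] at hxa, hx0⟩
  have hy : y ∈ slitPlane :=
    mem_slitPlane_iff_arg.2 ⟨fun h => by simp [h, abs_of_pos Real.pi_pos] at hya, hy0⟩
  refine ⟨integrableOn_carlsonRFIntegrand hx hy, integrableOn_carlsonRGIntegrand hx hy,
    agm_re_pos hx hy, fun r hr => exists_agmStop hx hy hr, fun r n hr hr' h => ?_,
    fun r n F hr hr' h hF => ?_, eventually_relErrorLT_carlsonRG hx hy⟩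
  · refine (norm_carlsonRF_sub_agmRF_le_of_agmStop hx hy hr hr' h).trans_lt ?_
    have : 0 < ‖agmRF x y n‖ := norm_pos_iff.2
      (div_ne_zero (by exact_mod_cast Real.pi_ne_zero) (agm_add_ne_zero hx hy n))
    gcongr
    linarith
  · refine (norm_two_mul_carlsonRG_sub_agmTwoRG_le hx hy hr hr' h hF).trans_lt ?_
    have hX : 0 < ‖agmX x y n‖ := (agm_re_pos hx hy n).1.trans_le (re_le_norm _)
    have hX' := norm_agmX_succ_le_of_agmStop hr' h
    have hq := sq_norm_agmRatio_le_of_agmStop hr hr' h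
    refine add_lt_add_of_le_of_lt (by gcongr; linarith) ?_
    calc 16 * (2 ^ n * ‖agmX x y (n + 1)‖ * ‖agmRatio x y n‖ ^ 4)
        = 16 * (2 ^ n * ‖agmX x y (n + 1)‖ * (‖agmRatio x y n‖ ^ 2) ^ 2) := by ring
      _ ≤ 16 * (2 ^ n * (2 * ‖agmX x y n‖) * (3.42 * r) ^ 2) := by gcongr
      _ = 374.2848 * (2 ^ n * ‖agmX x y n‖ * r ^ 2) := by ring
      _ < 1000 * (2 ^ n * ‖agmX x y n‖ * r ^ 2) := by
        gcongr
        norm_num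
      _ = _ := by ring
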